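/- Let $k$ be an algebraically closed field of characteristic zero, $N\cong\mathbb{Z}^n$ a lattice, $M=\mathrm{Hom}_{\mathbb Z}(N,\mathbb{Z})$ its dual, $N_{\mathbb R}=N\otimes_{\mathbb Z}\mathbb{R}$ and $M_{\mathbb R}=M\otimes_{\mathbb Z}\mathbb{R}$. Let $\sigma\subset N_{\mathbb R}$ be a convex cone that is generated by finitely many vectors of $N$, contains no nonzero linear subspace and spans $N_{\mathbb R}$; let $\sigma^\vee\subset M_{\mathbb R}$ be its dual cone, $X=\mathrm{Spec}\,k[M\cap\sigma^\vee]$ the associated affine toric variety, with monomials $\chi^u$, and $T=\mathrm{Spec}\,k[M]$ its torus. For $m\ge 0$ let $X_m$ and $T_m$ be the $m$-th jet schemes of $X$ and $T$ (we consider $k$-valued points with the Zariski topology, i.e. $k$-algebra homomorphisms $\gamma^*$ from the coordinate ring to $k[t]/(t^{m+1})$). The group $T_m$ acts on $X_m$ by $(g\cdot\gamma)^*(\chi^u)=g^*(\chi^u)\,\gamma^*(\chi^u)$. For a lattice point $a\in\sigma\cap N$, let $T_{m,a}\subset X_m$ be the $T_m$-orbit corresponding to $a$: the set of the $m$-jets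 $\gamma$ that lift to an arc $\delta$ of $X$, $\delta^*\colon k[M\cap\sigma^\vee]\to k[[t]]$, such that for every $u\in M\cap\sigma^\vee$ one has $\delta^*(\chi^u)\neq 0$, and either $\mathrm{ord}_t\,\delta^*(\chi^u)=\langle a,u\rangle\le m$, or both $\mathrm{ord}_t\,\delta^*(\chi^u)$ and $\langle a,u\rangle$ are larger than $m$. Let $u_1,\dots,u_s\in M\cap\sigma^\vee$ be such that $\chi^{u_1},\dots,\chi^{u_s}$ is the minimal set of monomial generators of $k[M\cap\sigma^\vee]$. Fix a lattice point $a$ in the interior of $\sigma$ and $m\ge 0$, and let $H_{m,a}\subset T_m$ be the stabilizer of an arbitrary element of $T_{m,a}$. Put $$\Phi(a)=\min\Big\{\sum_{i=1}^n\langle a,v_i\rangle \;\Big|\; v_1,\dots,v_n\in M\cap\sigma^\vee\text{ span }M_{\mathbb R}\Big\}$$ (this minimum exists), and consider the inequality $$(\ast)\qquad m\ \ge\ \max\,\langle a,u_{j_i}\rangle,$$ where the maximum is over all $1\le i\le n$ and all choices of $n$ vectors $u_{j_1},\dots,u_{j_n}$ among $u_1,\dots,u_s$ that span $M_{\mathbb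 R}$ and satisfy $\sum_{i=1}^n\langle a,u_{j_i}\rangle=\Phi(a)$. Then: (1) If $m$ satisfies $(\ast)$, then $\dim H_{m,a}=\Phi(a)$. (2) If $m$ does not satisfy $(\ast)$, then either $\dim H_{m,a}=\Phi(a)$ or $m\le\dim H_{m,a}\le\Phi(a)$. -/

import Mathlib

open scoped TensorProduct

noncomputable section

/-! ## Jets of affine schemes -/

/-- The ring `A[t]/(t^(m+1))`. -/
abbrev JetRing (A : Type*) [CommRing A] (m : ℕ) : Type _ :=
  Polynomial A ⧸ Ideal.span {(Polynomial.X : Polynomial A) ^ (m + 1)}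

namespace JetRing

variable {A : Type*} [CommRing A] {m : ℕ}

/-- The class of a polynomial in `A[t]/(t^(m+1))`. -/
def mk (m : ℕ) (f : Polynomial A) : JetRing A m := Ideal.Quotient.mk _ f

theorem mk_surjective : Function.Surjective (mk m : Polynomial A → JetRing A m) :=
  Ideal.Quotient.mk_surjective

theorem mk_eq_mk {f g : Polynomial A} :
    mk m f = mk m g ↔ ∀ j < m + 1, f.coeff j = g.coeff j := by
  unfold mk
  rw [Ideal.Quotient.eq, Ideal.mem_span_singleton, Polynomial.X_pow_dvd_iff]
  simp [sub_eq_zero]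

/-- The coefficient of `t^j` of an element of `A[t]/(t^(m+1))`, for `0 ≤ j ≤ m`. -/
def coeff (x : JetRing A m) (j : Fin (m + 1)) : A :=
  Quotient.liftOn' x (fun f : Polynomial A => f.coeff j) (fun _ _ h =>
    (mk_eq_mk (m := m)).1 (Quotient.sound' h) j j.2)

@[simp] theorem coeff_mk (f : Polynomial A) (j : Fin (m + 1)) : (mk m f).coeff j = f.coeff j := rfl

theorem ext {x y : JetRing A m} (h : ∀ j, x.coeff j = y.coeff j) : x = y := by
  obtain ⟨f, rfl⟩ := mk_surjective x
  obtain ⟨g, rfl⟩ := mk_surjective y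
  exact mk_eq_mk.2 fun j hj => h ⟨j, hj⟩

@[simp] theorem coeff_add (x y : JetRing A m) (j : Fin (m + 1)) :
    (x + y).coeff j = x.coeff j + y.coeff j := by
  obtain ⟨f, rfl⟩ := mk_surjective x
  obtain ⟨g, rfl⟩ := mk_surjective y
  exact Polynomial.coeff_add f g j

theorem sum_antidiagonal_eq (m : ℕ) (F : ℕ → ℕ → A) (j : Fin (m + 1)) :
    ∑ p ∈ Finset.HasAntidiagonal.antidiagonal (j : ℕ), F p.1 p.2 =
      ∑ p : Fin (m + 1) × Fin (m + 1) with (p.1 : ℕ) + p.2 = j, F p.1 p.2 := by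
  symm
  refine Finset.sum_bij (fun p _ => ((p.1 : ℕ), (p.2 : ℕ))) ?_ ?_ ?_ ?_
  · intro p hp; simpa using hp
  · rintro ⟨a, b⟩ _ ⟨c, d⟩ _ h
    simp only [Prod.mk.injEq] at h
    exact Prod.ext (Fin.ext h.1) (Fin.ext h.2)
  · rintro ⟨a, b⟩ h
    have hj := j.2
    rw [Finset.HasAntidiagonal.mem_antidiagonal] at h
    dsimp only at h
    exact ⟨(⟨a, by omega⟩, ⟨b, by omega⟩), by simpa using h, rfl⟩
  · intro p _; rfl

theorem coeff_mul (x y : JetRing A m) (j : Fin (m + 1)) :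
    (x * y).coeff j =
      ∑ p : Fin (m + 1) × Fin (m + 1) with (p.1 : ℕ) + p.2 = j, x.coeff p.1 * y.coeff p.2 := by
  obtain ⟨f, rfl⟩ := mk_surjective x
  obtain ⟨g, rfl⟩ := mk_surjective y
  have h : mk m f * mk m g = mk m (f * g) := (map_mul (Ideal.Quotient.mk _) f g).symm
  rw [h, coeff_mk, Polynomial.coeff_mul]
  exact sum_antidiagonal_eq m (fun p q => f.coeff p * g.coeff q) j

theorem coeff_algebraMap {k : Type*} [CommRing k] [Algebra k A] (c : k) (j : Fin (m + 1)) :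
    (algebraMap k (JetRing A m) c).coeff j = if j = 0 then algebraMap k A c else 0 := by
  have h : algebraMap k (JetRing A m) c = mk m (Polynomial.C (algebraMap k A c)) := rfl
  rw [h, coeff_mk, Polynomial.coeff_C]
  simp only [← Fin.val_eq_zero_iff]

/-- The element `∑ a_j t^j` of `A[t]/(t^(m+1))`. -/
def ofCoeff (a : Fin (m + 1) → A) : JetRing A m :=
  mk m (∑ j : Fin (m + 1), Polynomial.monomial (j : ℕ) (a j))

@[simp] theorem coeff_ofCoeff (a : Fin (m + 1) → A) (j : Fin (m + 1)) :
    (ofCoeff a).coeff j = a j := by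
  simp [ofCoeff, Polynomial.coeff_monomial, ← Fin.ext_iff]

end JetRing

section JetAlgebra

variable (k : Type*) [CommRing k] (m : ℕ) (R : Type*) [CommRing R] [Algebra k R]

/-- The relations that the coefficients `r^(j)` of the universal `m`-jet
`r ↦ r^(0) + r^(1) t + ⋯ + r^(m) t^m` have to satisfy. -/
def jetIdeal : Ideal (MvPolynomial (R × Fin (m + 1)) k) :=
  Ideal.span
    ({f | ∃ (r s : R) (j : Fin (m + 1)),
        f = MvPolynomial.X (r + s, j) - (MvPolynomial.X (r, j) + MvPolynomial.X (s, j))} ∪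
     {f | ∃ (r s : R) (j : Fin (m + 1)),
        f = MvPolynomial.X (r * s, j) -
          ∑ p : Fin (m + 1) × Fin (m + 1) with (p.1 : ℕ) + p.2 = j,
            MvPolynomial.X (r, p.1) * MvPolynomial.X (s, p.2)} ∪
     {f | ∃ (c : k) (j : Fin (m + 1)),
        f = MvPolynomial.X (algebraMap k R c, j) - if j = 0 then MvPolynomial.C c else 0})

/-- The coordinate ring of the `m`-th jet scheme of `Spec R`; see `jetEquiv`. -/
abbrev JetAlgebra : Type _ := MvPolynomial (R × Fin (m + 1)) k ⧸ jetIdeal k m R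

variable {R} in
/-- The coordinate `r^(j)` on the jet scheme. -/
def jetCoord (r : R) (j : Fin (m + 1)) : JetAlgebra k m R :=
  Ideal.Quotient.mk (jetIdeal k m R) (MvPolynomial.X (r, j))

variable {k m R}

theorem jetCoord_add (r s : R) (j : Fin (m + 1)) :
    jetCoord k m (r + s) j = jetCoord k m r j + jetCoord k m s j :=
  ((Ideal.Quotient.eq (I := jetIdeal k m R)).2 (Ideal.subset_span (Or.inl (Or.inl ⟨r, s, j, rfl⟩)))).trans
    (map_add _ _ _)

theorem jetCoord_mul (r s : R) (j : Fin (m + 1)) :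
    jetCoord k m (r * s) j = ∑ p : Fin (m + 1) × Fin (m + 1) with (p.1 : ℕ) + p.2 = j,
      jetCoord k m r p.1 * jetCoord k m s p.2 :=
  ((Ideal.Quotient.eq (I := jetIdeal k m R)).2 (Ideal.subset_span (Or.inl (Or.inr ⟨r, s, j, rfl⟩)))).trans
    (by simp [jetCoord, map_sum])

theorem jetCoord_algebraMap (c : k) (j : Fin (m + 1)) :
    jetCoord k m (algebraMap k R c) j = if j = 0 then algebraMap k _ c else 0 :=
  ((Ideal.Quotient.eq (I := jetIdeal k m R)).2 (Ideal.subset_span (Or.inr ⟨c, j, rfl⟩))).trans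
    (by split_ifs <;> rfl)

/-- `A`-valued points of `Spec (JetAlgebra k m R)` are the `A`-valued `m`-jets of `Spec R`: the
homomorphism `φ` corresponds to the jet `r ↦ φ(r^(0)) + φ(r^(1)) t + ⋯ + φ(r^(m)) t^m`.
So `Spec (JetAlgebra k m R)` is the `m`-th jet scheme of `Spec R`. -/
def jetEquiv (A : Type*) [CommRing A] [Algebra k A] :
    (JetAlgebra k m R →ₐ[k] A) ≃ (R →ₐ[k] JetRing A m) where
  toFun φ :=
    AlgHom.ofLinearMap
      { toFun := fun r => JetRing.ofCoeff fun j => φ (jetCoord k m r j)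
        map_add' := fun r s => JetRing.ext fun j => by simp [jetCoord_add]
        map_smul' := fun c r => JetRing.ext fun j => by
          simp only [Algebra.smul_def, jetCoord_mul, jetCoord_algebraMap, JetRing.coeff_ofCoeff,
            RingHom.id_apply, JetRing.coeff_mul, JetRing.coeff_algebraMap, map_sum, map_mul]
          refine Finset.sum_congr rfl fun p _ => ?_
          split_ifs <;> simp }
      (JetRing.ext fun j => by
        have h1 := JetRing.coeff_algebraMap (A := A) (m := m) (1 : k) j
        have h2 := jetCoord_algebraMap (R := R) (m := m) (1 : k) j
        simp only [map_one] at h1 h2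
        simp only [LinearMap.coe_mk, AddHom.coe_mk, JetRing.coeff_ofCoeff, h1, h2]
        split_ifs <;> simp)
      (fun r s => JetRing.ext fun j => by
        simp [jetCoord_mul, JetRing.coeff_mul])
  invFun γ := Ideal.Quotient.liftₐ (jetIdeal k m R)
    (MvPolynomial.aeval fun p : R × Fin (m + 1) => (γ p.1).coeff p.2) (by
      intro f hf
      change f ∈ RingHom.ker (MvPolynomial.aeval fun p : R × Fin (m + 1) => (γ p.1).coeff p.2)
      revert f
      change jetIdeal k m R ≤ _
      rw [jetIdeal, Ideal.span_le]
      rintro f ((⟨r, s, j, rfl⟩ | ⟨r, s, j, rfl⟩) | ⟨c, j, rfl⟩)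
      · simp [RingHom.mem_ker]
      · simp [RingHom.mem_ker, JetRing.coeff_mul]
      · have := JetRing.coeff_algebraMap (A := A) (m := m) c j
        simp only [SetLike.mem_coe, RingHom.mem_ker, map_sub, MvPolynomial.aeval_X,
          AlgHom.commutes, this]
        split_ifs <;> simp)
  left_inv φ := by
    apply Ideal.Quotient.algHom_ext
    apply MvPolynomial.algHom_ext
    rintro ⟨r, j⟩
    simp only [AlgHom.comp_apply, Ideal.Quotient.mkₐ_eq_mk, Ideal.Quotient.liftₐ_apply]
    exact (Ideal.Quotient.lift_mk _ _ _).trans (by simp [jetCoord])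
  right_inv γ := by
    apply AlgHom.ext
    intro r
    apply JetRing.ext
    intro j
    refine (JetRing.coeff_ofCoeff _ j).trans ?_
    refine (Ideal.Quotient.lift_mk _ _ _).trans ?_
    simp

end JetAlgebra

/-- The `m`-jets (i.e. the `k`-valued points of the `m`-th jet scheme) of `Spec R`. -/
@[ext]
structure JetPoint (k : Type*) [CommRing k] (m : ℕ) (R : Type*) [CommRing R] [Algebra k R] where
  /-- The homomorphism `γ^*` of the jet `γ : Spec k[t]/(t^(m+1)) → Spec R`. -/
  hom : R →ₐ[k] JetRing k m

/-- A `k`-valued point of the jet scheme, as a point of the scheme. -/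
def JetPoint.toSpec {k : Type*} [Field k] {m : ℕ} {R : Type*} [CommRing R] [Algebra k R]
    (γ : JetPoint k m R) : PrimeSpectrum (JetAlgebra k m R) :=
  ⟨RingHom.ker ((jetEquiv k).symm γ.hom), RingHom.ker_isPrime _⟩

/-- The Zariski topology on the set of `k`-valued points of the jet scheme. -/
instance JetPoint.instTopologicalSpace {k : Type*} [Field k] {m : ℕ} {R : Type*} [CommRing R]
    [Algebra k R] : TopologicalSpace (JetPoint k m R) :=
  TopologicalSpace.induced JetPoint.toSpec inferInstance

/-- The `k`-valued arcs of `Spec R`. -/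
abbrev ArcPoint (k : Type*) [CommRing k] (R : Type*) [CommRing R] [Algebra k R] : Type _ :=
  R →ₐ[k] PowerSeries k

/-- The truncation `k⟦t⟧ → k[t]/(t^(m+1))`. -/
def truncHom (k : Type*) [CommRing k] (m : ℕ) : PowerSeries k →ₐ[k] JetRing k m :=
  AlgHom.ofLinearMap
    { toFun := fun f => JetRing.ofCoeff fun j => PowerSeries.coeff (j : ℕ) f
      map_add' := fun f g => JetRing.ext fun j => by simp
      map_smul' := fun c f => JetRing.ext fun j => by
        obtain ⟨p, hp⟩ := JetRing.mk_surjective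
          (JetRing.ofCoeff fun j : Fin (m + 1) => PowerSeries.coeff (j : ℕ) f)
        have h : c • JetRing.mk m p = JetRing.mk m (c • p) := rfl
        have h2 := congrArg (fun x => JetRing.coeff x j) hp
        simp only [JetRing.coeff_ofCoeff, JetRing.coeff_mk] at h2
        simp only [RingHom.id_apply]
        rw [← hp, h]
        simp [h2] }
    (JetRing.ext fun j => by
      have h := JetRing.coeff_algebraMap (A := k) (m := m) (1 : k) j
      simp only [map_one] at h
      simp only [LinearMap.coe_mk, AddHom.coe_mk, JetRing.coeff_ofCoeff, h,
        PowerSeries.coeff_one, ← Fin.val_eq_zero_iff])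
    (fun f g => JetRing.ext fun j => by
      simp only [LinearMap.coe_mk, AddHom.coe_mk, JetRing.coeff_ofCoeff, JetRing.coeff_mul,
        PowerSeries.coeff_mul]
      exact JetRing.sum_antidiagonal_eq m
        (fun p q => PowerSeries.coeff p f * PowerSeries.coeff q g) j)

/-- The canonical map `ψ_m` from arcs to `m`-jets. -/
def ArcPoint.toJet {k : Type*} [CommRing k] {R : Type*} [CommRing R] [Algebra k R] (m : ℕ)
    (δ : ArcPoint k R) : JetPoint k m R :=
  ⟨(truncHom k m).comp δ⟩

/-! ## Cones, toric varieties and the torus action on jets -/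

section Toric

variable {N : Type*} [AddCommGroup N]

/-- `σ` is generated, as a convex cone in `N_ℝ = ℝ ⊗ N`, by finitely many lattice vectors. -/
def IsRationalPolyhedral (σ : PointedCone ℝ (ℝ ⊗[ℤ] N)) : Prop :=
  ∃ S : Finset N, σ = PointedCone.hull ℝ ((fun v : N => (1 : ℝ) ⊗ₜ[ℤ] v) '' (S : Set N))

/-- The interior of `σ` in the canonical (module) topology of the real vector space `N_ℝ`. -/
def coneInterior (σ : PointedCone ℝ (ℝ ⊗[ℤ] N)) : Set (ℝ ⊗[ℤ] N) :=
  @interior (ℝ ⊗[ℤ] N) (moduleTopology ℝ (ℝ ⊗[ℤ] N)) (σ : Set (ℝ ⊗[ℤ] N))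

/-- The semigroup `M ∩ σ^∨`, where `M = Hom(N, ℤ)`. -/
def dualMonoid (σ : PointedCone ℝ (ℝ ⊗[ℤ] N)) : AddSubmonoid (Module.Dual ℤ N) where
  carrier := {u | ∀ v ∈ σ, 0 ≤ Module.Dual.baseChange ℝ u v}
  zero_mem' := fun v _ => by simp
  add_mem' := fun {u w} hu hw v hv => by simpa using add_nonneg (hu v hv) (hw v hv)

/-- The monomial `χ^u`. -/
def chi (k : Type*) [CommRing k] {S : Type*} [AddCommMonoid S] (u : S) : AddMonoidAlgebra k S :=
  AddMonoidAlgebra.single u 1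

theorem chi_zero (k : Type*) [CommRing k] {S : Type*} [AddCommMonoid S] :
    chi k (0 : S) = 1 := rfl

theorem chi_add (k : Type*) [CommRing k] {S : Type*} [AddCommMonoid S] (u v : S) :
    chi k (u + v) = chi k u * chi k v := by
  simp [chi, AddMonoidAlgebra.single_mul_single]

/-- The `k`-algebra homomorphism out of `k[S]` with prescribed values on the monomials. -/
def ofMonomials {k : Type*} [CommRing k] {S : Type*} [AddCommMonoid S] {B : Type*} [CommRing B]
    [Algebra k B] (f : S → B) (h0 : f 0 = 1) (hadd : ∀ u v, f (u + v) = f u * f v) :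
    AddMonoidAlgebra k S →ₐ[k] B :=
  AddMonoidAlgebra.lift k B S
    { toFun := fun u => f u.toAdd, map_one' := h0, map_mul' := fun u v => hadd u.toAdd v.toAdd }

@[simp] theorem ofMonomials_chi {k : Type*} [CommRing k] {S : Type*} [AddCommMonoid S] {B : Type*}
    [CommRing B] [Algebra k B] (f : S → B) (h0 : f 0 = 1)
    (hadd : ∀ u v, f (u + v) = f u * f v) (u : S) :
    ofMonomials (k := k) f h0 hadd (chi k u) = f u := by
  simp [ofMonomials, chi]

theorem algHom_ext_chi {k : Type*} [CommRing k] {S : Type*} [AddCommMonoid S] {B : Type*}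
    [CommRing B] [Algebra k B] {f g : AddMonoidAlgebra k S →ₐ[k] B}
    (h : ∀ u, f (chi k u) = g (chi k u)) : f = g :=
  AddMonoidAlgebra.algHom_ext h (Subsingleton.elim _ _)

section Action

variable {k : Type*} [Field k] {m : ℕ} {M : Type*} [AddCommGroup M]

/-- The product in `T_m`: `(g * h)(χ^u) = g(χ^u) h(χ^u)`. -/
def JetPoint.mul (g h : JetPoint k m (AddMonoidAlgebra k M)) :
    JetPoint k m (AddMonoidAlgebra k M) where
  hom := ofMonomials (fun u => g.hom (chi k u) * h.hom (chi k u))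
    (by simp [chi_zero]) (fun u v => by simp only [chi_add, map_mul]; ring)

/-- The unit element of `T_m`: `1(χ^u) = 1`. -/
def JetPoint.one : JetPoint k m (AddMonoidAlgebra k M) where
  hom := ofMonomials (fun _ => 1) rfl (by simp)

/-- The inverse in `T_m`: `g⁻¹(χ^u) = g(χ^(-u))`. -/
def JetPoint.inv (g : JetPoint k m (AddMonoidAlgebra k M)) :
    JetPoint k m (AddMonoidAlgebra k M) where
  hom := ofMonomials (fun u => g.hom (chi k (-u)))
    (by simp [chi_zero]) (fun u v => by rw [neg_add, chi_add, map_mul])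

/-- The action of `T_m` on jets: `(g • γ)(χ^u) = g(χ^u) γ(χ^u)`. -/
def JetPoint.smul {S : AddSubmonoid M} (g : JetPoint k m (AddMonoidAlgebra k M))
    (γ : JetPoint k m (AddMonoidAlgebra k S)) : JetPoint k m (AddMonoidAlgebra k S) where
  hom := ofMonomials (fun u => g.hom (chi k (u : M)) * γ.hom (chi k u))
    (by simp [chi_zero])
    (fun u v => by rw [AddSubmonoid.coe_add]; simp only [chi_add, map_mul]; ring)

instance JetPoint.instMul : Mul (JetPoint k m (AddMonoidAlgebra k M)) := ⟨JetPoint.mul⟩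

instance JetPoint.instOne : One (JetPoint k m (AddMonoidAlgebra k M)) := ⟨JetPoint.one⟩

instance JetPoint.instInv : Inv (JetPoint k m (AddMonoidAlgebra k M)) := ⟨JetPoint.inv⟩

instance JetPoint.instSMul (S : AddSubmonoid M) :
    SMul (JetPoint k m (AddMonoidAlgebra k M)) (JetPoint k m (AddMonoidAlgebra k S)) :=
  ⟨JetPoint.smul⟩

theorem JetPoint.mul_chi (g h : JetPoint k m (AddMonoidAlgebra k M)) (u : M) :
    (g * h).hom (chi k u) = g.hom (chi k u) * h.hom (chi k u) := by
  change (JetPoint.mul g h).hom (chi k u) = _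
  rw [JetPoint.mul, ofMonomials_chi]

theorem JetPoint.one_chi (u : M) :
    (1 : JetPoint k m (AddMonoidAlgebra k M)).hom (chi k u) = 1 := by
  change (JetPoint.one).hom (chi k u) = _
  rw [JetPoint.one, ofMonomials_chi]

theorem JetPoint.inv_chi (g : JetPoint k m (AddMonoidAlgebra k M)) (u : M) :
    g⁻¹.hom (chi k u) = g.hom (chi k (-u)) := by
  change (JetPoint.inv g).hom (chi k u) = _
  rw [JetPoint.inv, ofMonomials_chi]

theorem JetPoint.smul_chi (S : AddSubmonoid M) (g : JetPoint k m (AddMonoidAlgebra k M))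
    (γ : JetPoint k m (AddMonoidAlgebra k S)) (u : S) :
    (g • γ).hom (chi k u) = g.hom (chi k (u : M)) * γ.hom (chi k u) := by
  change (JetPoint.smul g γ).hom (chi k u) = _
  rw [JetPoint.smul, ofMonomials_chi]

theorem JetPoint.ext_chi {S : Type*} [AddCommMonoid S] {g h : JetPoint k m (AddMonoidAlgebra k S)}
    (H : ∀ u, g.hom (chi k u) = h.hom (chi k u)) : g = h :=
  JetPoint.ext (algHom_ext_chi H)

/-- The group `T_m` of `m`-jets of the torus `T = Spec k[M]`; its multiplication is induced by the
one of `T`, i.e. `(g * h)(χ^u) = g(χ^u) h(χ^u)`. -/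
instance JetPoint.instCommGroup : CommGroup (JetPoint k m (AddMonoidAlgebra k M)) where
  mul_assoc f g h := ext_chi fun u => by simp only [mul_chi, mul_assoc]
  one_mul g := ext_chi fun u => by rw [mul_chi, one_chi, one_mul]
  mul_one g := ext_chi fun u => by rw [mul_chi, one_chi, mul_one]
  mul_comm g h := ext_chi fun u => by rw [mul_chi, mul_chi, mul_comm]
  inv_mul_cancel g := ext_chi fun u => by
    rw [mul_chi, inv_chi, one_chi, ← map_mul, ← chi_add, neg_add_cancel, chi_zero, map_one]

/-- The action of `T_m` on the `m`-jets of `Spec k[S]`, for a subsemigroup `S` of `M`, induced by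
the torus action `χ^u ↦ χ^u ⊗ χ^u`, i.e. `(g • γ)(χ^u) = g(χ^u) γ(χ^u)`. -/
instance JetPoint.instMulAction (S : AddSubmonoid M) :
    MulAction (JetPoint k m (AddMonoidAlgebra k M)) (JetPoint k m (AddMonoidAlgebra k S)) where
  one_smul γ := ext_chi fun u => by rw [smul_chi, one_chi, one_mul]
  mul_smul g h γ := ext_chi fun u => by simp only [smul_chi, mul_chi, mul_assoc]

end Action

/-- The truncation `Tr_m`, sending every order larger than `m` to `∞`. -/
def truncOrd (m : ℕ) (e : ℕ∞) : ℕ∞ := if e ≤ m then e else ⊤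

/-- The `T_m`-orbit `T_{m,a}`: the set of the `m`-jets `γ` of `X = Spec k[M ∩ σ^∨]` that lift to
an arc `δ` lying in no arc space `(D_i)_∞` of a torus-invariant prime divisor `D_i` of `X` (i.e.
`δ(χ^u) ≠ 0` for all `u`), and whose order map `u ↦ Tr_m (ord_t δ(χ^u))` is the truncation of
`u ↦ ⟨a, u⟩`. (For `a ∈ σ` the integer `⟨a, u⟩` is nonnegative.) -/
def jetOrbit (k : Type*) [Field k] (σ : PointedCone ℝ (ℝ ⊗[ℤ] N)) (m : ℕ) (a : N) :
    Set (JetPoint k m (AddMonoidAlgebra k (dualMonoid σ))) :=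
  {γ | ∃ δ : ArcPoint k (AddMonoidAlgebra k (dualMonoid σ)),
    (∀ u, δ (chi k u) ≠ 0) ∧ δ.toJet m = γ ∧
    ∀ u : dualMonoid σ, truncOrd m (δ (chi k u)).order =
      truncOrd m (((u : Module.Dual ℤ N) a).toNat : ℕ∞)}

theorem dualMonoid_apply_nonneg {σ : PointedCone ℝ (ℝ ⊗[ℤ] N)} {a : N}
    (ha : (1 : ℝ) ⊗ₜ[ℤ] a ∈ σ) (u : dualMonoid σ) : 0 ≤ (u : Module.Dual ℤ N) a := by
  have h := u.2 _ ha
  simpa using h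

/-- `T_{m,a}` is not empty: it contains the jet `χ^u ↦ t^⟨a, u⟩`. -/
theorem jetOrbit_nonempty (k : Type*) [Field k] (σ : PointedCone ℝ (ℝ ⊗[ℤ] N)) (m : ℕ) {a : N}
    (ha : (1 : ℝ) ⊗ₜ[ℤ] a ∈ σ) : (jetOrbit k σ m a).Nonempty := by
  refine ⟨_, ofMonomials (fun u => (PowerSeries.X : PowerSeries k) ^
    ((u : Module.Dual ℤ N) a).toNat) (by simp) (fun u v => ?_), fun u => ?_, rfl, fun u => ?_⟩
  · rw [← pow_add, ← Int.toNat_add (dualMonoid_apply_nonneg ha u) (dualMonoid_apply_nonneg ha v)]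
    rfl
  · rw [ofMonomials_chi]
    exact pow_ne_zero _ PowerSeries.X_ne_zero
  · rw [ofMonomials_chi, PowerSeries.order_X_pow]

/-- The vectors `u_1, …, u_n` of `M ∩ σ^∨`, with `n` the rank of `N`, span `M_ℝ = ℝ ⊗ M`. -/
def IsSpanningTuple {σ : PointedCone ℝ (ℝ ⊗[ℤ] N)}
    (u : Fin (Module.finrank ℤ N) → dualMonoid σ) : Prop :=
  Submodule.span ℝ
    (Set.range fun i => (1 : ℝ) ⊗ₜ[ℤ] (u i : Module.Dual ℤ N)) = ⊤

/-- The set of the values `⟨a, u_1⟩ + ⋯ + ⟨a, u_n⟩`, for `u_1, …, u_n ∈ M ∩ σ^∨` that span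
`M_ℝ`. -/
def spanningSums (σ : PointedCone ℝ (ℝ ⊗[ℤ] N)) (a : N) : Set ℤ :=
  {s | ∃ u : Fin (Module.finrank ℤ N) → dualMonoid σ,
    IsSpanningTuple u ∧ s = ∑ i, (u i : Module.Dual ℤ N) a}

/-- `Φ(a)`, the minimum of `spanningSums σ a`. -/
def Phi (σ : PointedCone ℝ (ℝ ⊗[ℤ] N)) (a : N) : ℤ := sInf (spanningSums σ a)

/-- The set of the integers `⟨a, u_{j_i}⟩`, where `u_{j_1}, …, u_{j_n}` runs over the tuples of
elements of `G` that span `M_ℝ` and attain the minimum `Φ(a)`. -/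
def minimizingValues (σ : PointedCone ℝ (ℝ ⊗[ℤ] N)) (G : Set (dualMonoid σ)) (a : N) : Set ℤ :=
  {s | ∃ u : Fin (Module.finrank ℤ N) → dualMonoid σ,
    (∀ i, u i ∈ G) ∧ IsSpanningTuple u ∧ ∑ i, (u i : Module.Dual ℤ N) a = Phi σ a ∧
    ∃ i, s = (u i : Module.Dual ℤ N) a}

/-- `G` is the minimal set of semigroup elements whose monomials generate `k[M ∩ σ^∨]`. -/
def IsMinimalMonomialGenerators (k : Type*) [Field k] (σ : PointedCone ℝ (ℝ ⊗[ℤ] N))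
    (G : Set (dualMonoid σ)) : Prop :=
  Minimal (fun G : Set (dualMonoid σ) => Algebra.adjoin k (chi k '' G) = ⊤) G

end Toric

end

/-!
Write `⟨a, u⟩` for the height of a character `u`. Multiplying by a power series of order `e` kills
exactly the jets divisible by `t^(m+1-e)`, so the stabilizer of a jet in `T_{m,a}` consists of the
`g ∈ T_m` with `g(χ^u) ≡ 1 mod t^(m+1-⟨a, u⟩)` for all `u ∈ M ∩ σ^∨`.

The sublattices of `M` spanned by the `u ∈ M ∩ σ^∨` of height at most `j` form a filtration, and
`M` has a basis `b_i` adapted to its saturation; let `w_i` be the weight of `b_i`. The coefficients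
of the `g(χ^(b_i))` make `T_m` an open subset of an affine space. The stabilizer contains the
subgroup given by `g(χ^(b_i)) ≡ 1 mod t^(m+1-w_i)` for all `i`. Conversely some nonzero multiple
`c_i b_i` lies in the `w_i`-th step itself, so `g(χ^(b_i))^(c_i) ≡ 1`, which in characteristic zero
leaves only finitely many choices for each constrained coefficient. Hence the dimension is
`∑ min(w_i, m + 1)`.

If `v_1, …, v_n` span `M_ℝ`, some term of the Leibniz expansion of their determinant in the basis
`b` is nonzero, and it matches each `v_i` with a basis vector of weight at most `⟨a, v_i⟩`.
Exchanging the basis vectors one at a time for generators of the corresponding step produces a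
tuple for which all these inequalities are equalities. So `Φ(a) = ∑ w_i`, and every `w_i` is among
the integers over which the maximum in `(∗)` is taken.
-/

open TopologicalSpace Topology

noncomputable section

/-! ## Krull dimension -/

section KrullDimension

variable {X Y : Type*} [TopologicalSpace X] [TopologicalSpace Y]

theorem topologicalKrullDim_le_of_mapsTo {f : X → Y} (hf : IsInducing f) {H : Set X} {B : Set Y}
    (h : Set.MapsTo f H B) : topologicalKrullDim H ≤ topologicalKrullDim B := by
  refine IsInducing.topologicalKrullDim_le (f := h.restrict f H B) ?_
  exact IsInducing.of_comp (hf.continuous.continuousOn.mapsToRestrict h) continuous_subtype_val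
    (hf.comp IsInducing.subtypeVal)

theorem topologicalKrullDim_le_of_subset_image {f : X → Y} (hf : IsInducing f) {H : Set X}
    {B : Set Y} (h : B ⊆ f '' H) : topologicalKrullDim B ≤ topologicalKrullDim H := by
  choose g hgH hfg using fun y : B => h y.2
  refine IsInducing.topologicalKrullDim_le (f := fun y => (⟨g y, hgH y⟩ : H)) ?_
  have hcomp : IsInducing (f ∘ Subtype.val ∘ fun y => (⟨g y, hgH y⟩ : H)) := by
    rw [show f ∘ Subtype.val ∘ (fun y => (⟨g y, hgH y⟩ : H)) = Subtype.val from funext hfg]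
    exact IsInducing.subtypeVal
  exact IsInducing.subtypeVal.of_comp_iff.1 (hf.of_comp_iff.1 hcomp)

theorem isIrreducible_of_image {f : X → Y} (hf : IsInducing f) {Z : Set X}
    (h : IsIrreducible (f '' Z)) : IsIrreducible Z := by
  refine ⟨h.1.of_image, fun U V hU hV hZU hZV => ?_⟩
  obtain ⟨U, hU', rfl⟩ := hf.isOpen_iff.1 hU
  obtain ⟨V, hV', rfl⟩ := hf.isOpen_iff.1 hV
  rw [← Set.preimage_inter]
  rw [← Set.image_nonempty (f := f), Set.image_inter_preimage] at hZU hZV ⊢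
  exact h.2 U V hU' hV' hZU hZV

theorem isIrreducible_preimage_val {Z W : Set X} (hW : IsIrreducible W) (h : W ⊆ Z) :
    IsIrreducible (Subtype.val ⁻¹' W : Set Z) := by
  refine isIrreducible_of_image IsInducing.subtypeVal ?_
  rwa [Subtype.image_preimage_coe, Set.inter_eq_right.2 h]

theorem topologicalKrullDim_le_of_forall_isIrreducible {d : WithBot ℕ∞}
    (h : ∀ Z : Set X, IsIrreducible Z → IsClosed Z → topologicalKrullDim Z ≤ d) :
    topologicalKrullDim X ≤ d := by
  rw [topologicalKrullDim, Order.krullDim_eq_iSup_height, iSup_le_iff]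
  intro Z
  rw [Order.height_eq_krullDim_Iic]
  refine le_trans ?_ (h Z Z.isIrreducible Z.isClosed)
  exact Order.krullDim_le_of_strictMono
    (fun W => ⟨Subtype.val ⁻¹' (W.1 : Set X), isIrreducible_preimage_val W.1.isIrreducible W.2,
      W.1.isClosed.preimage continuous_subtype_val⟩)
    fun W W' hlt => ⟨fun _ hx => hlt.1 hx, fun hle => hlt.2 fun x hx => @hle ⟨x, W'.2 hx⟩ hx⟩

theorem exists_eqOn_const_of_isIrreducible {α : Type*} {Z : Set X} (hZ : IsIrreducible Z)
    {f : X → α} (hf : ∀ c, IsClosed (f ⁻¹' {c})) (hfin : (f '' Z).Finite) :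
    ∃ c, Set.EqOn f (fun _ => c) Z := by
  classical
  obtain ⟨_, hmem, hsub⟩ := isIrreducible_iff_sUnion_isClosed.1 hZ
    (hfin.toFinset.image fun c => f ⁻¹' {c}) (by simpa using fun x _ => hf (f x))
    fun x hx => ⟨_, Finset.mem_coe.2 (Finset.mem_image_of_mem _
      (hfin.mem_toFinset.2 (Set.mem_image_of_mem f hx))), rfl⟩
  obtain ⟨c, -, rfl⟩ := Finset.mem_image.1 hmem
  exact ⟨c, fun x hx => hsub hx⟩

end KrullDimension

/-! ## Affine space with the Zariski topology -/

theorem natCard_le_krullDim_set (α : Type*) [Finite α] :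
    (Nat.card α : WithBot ℕ∞) ≤ Order.krullDim (Set α) := by
  let ψ := Finite.equivFin α
  exact Order.LTSeries.length_le_krullDim
    { length := Nat.card α
      toFun := fun i => {x | (ψ x : ℕ) < i}
      step := fun i => (Set.ssubset_iff_of_subset fun _ => Nat.lt_succ_of_lt).2
        ⟨ψ.symm i, show (ψ (ψ.symm i) : ℕ) < i + 1 by simp,
          show ¬(ψ (ψ.symm i) : ℕ) < i by simp⟩ }

/-- The affine space `k^E`, as the set of its `k`-valued points with the Zariski topology. It is a
type synonym of `E → k`, which keeps this topology apart from a product topology. -/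
def ZariskiSpace (k E : Type*) : Type _ := E → k

@[ext] theorem ZariskiSpace.ext {k E : Type*} {x y : ZariskiSpace k E} (h : ∀ e, x e = y e) :
    x = y :=
  funext h

namespace ZariskiSpace

variable {k E : Type*}

open scoped Classical in
/-- The embedding of `k^F` in `k^E` with constant coordinates `c e` for `e ∉ F`. -/
def extend (F : Set E) (c : E → k) (y : ZariskiSpace k F) : ZariskiSpace k E :=
  fun e => if he : e ∈ F then y ⟨e, he⟩ else c e

theorem extend_of_mem {F : Set E} (c : E → k) (y : ZariskiSpace k F) {e : E} (he : e ∈ F) :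
    extend F c y e = y ⟨e, he⟩ :=
  dif_pos he

theorem extend_of_notMem {F : Set E} (c : E → k) (y : ZariskiSpace k F) {e : E} (he : e ∉ F) :
    extend F c y e = c e :=
  dif_neg he

/-- The product of the subsets `s e` of the coordinate lines. -/
def box (s : E → Set k) : Set (ZariskiSpace k E) := {x | ∀ e, x e ∈ s e}

open scoped Classical in
theorem mem_box_piecewise_singleton {s : E → Set k} {c : E → k} (hc : ∀ e, c e ∈ s e) {T : Set E}
    {x : ZariskiSpace k E} :
    x ∈ box (T.piecewise s fun e => {c e}) ↔ x ∈ box s ∧ ∀ e ∉ T, x e = c e := by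
  simp only [box, Set.mem_ofPred_eq, ← forall_and]
  refine forall_congr' fun e => ?_
  by_cases he : e ∈ T
  · simp [he]
  · simp only [he, not_false_eq_true, Set.piecewise_eq_of_notMem, Set.mem_singleton_iff,
      forall_const, iff_and_self]
    exact fun h => h ▸ hc e

theorem exists_mem_box_apply_ne {s : E → Set k} {c : E → k} (hc : ∀ e, c e ∈ s e) {e : E}
    (he : (s e).Infinite) : ∃ x ∈ box s, x e ≠ c e ∧ ∀ i ≠ e, x i = c i := by
  classical
  obtain ⟨d, hds, hdc⟩ := he.exists_notMem_finite (Set.finite_singleton (c e))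
  refine ⟨Function.update c e d, fun i => ?_, by simpa using hdc, fun i hi => by simp [hi]⟩
  rcases eq_or_ne i e with rfl | hi
  · simpa using hds
  · simpa [hi] using hc i

variable [Field k]

/-- A `k`-valued point of the affine space, as a point of its scheme. -/
def toSpec (x : ZariskiSpace k E) : PrimeSpectrum (MvPolynomial E k) :=
  MvPolynomial.pointToPoint fun e => x e

instance : TopologicalSpace (ZariskiSpace k E) := .induced toSpec inferInstance

theorem isInducing_toSpec : IsInducing (toSpec (k := k) (E := E)) := ⟨rfl⟩

theorem mem_toSpec {x : ZariskiSpace k E} {p : MvPolynomial E k} :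
    p ∈ x.toSpec.asIdeal ↔ MvPolynomial.aeval (fun e => x e) p = 0 :=
  MvPolynomial.mem_vanishingIdeal_singleton_iff _ p

theorem continuous_of_forall_aeval {E' : Type*} {f : ZariskiSpace k E → ZariskiSpace k E'}
    (p : E' → MvPolynomial E k) (h : ∀ x e, f x e = MvPolynomial.aeval (fun i => x i) (p e)) :
    Continuous f := by
  have hcomap : toSpec ∘ f = PrimeSpectrum.comap (MvPolynomial.aeval p).toRingHom ∘ toSpec := by
    refine funext fun x => PrimeSpectrum.ext (Ideal.ext fun q => mem_toSpec.trans ?_)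
    rw [Function.comp_apply, PrimeSpectrum.comap_asIdeal, Ideal.mem_comap, mem_toSpec, funext (h x),
      AlgHom.toRingHom_eq_coe, RingHom.coe_coe, ← AlgHom.comp_apply, MvPolynomial.comp_aeval]
  rw [isInducing_toSpec.continuous_iff, hcomap]
  exact (PrimeSpectrum.continuous_comap _).comp isInducing_toSpec.continuous

theorem isClosed_setOf_apply_eq (e : E) (c : k) : IsClosed {x : ZariskiSpace k E | x e = c} := by
  have hzero : {x : ZariskiSpace k E | x e = c} =
      toSpec ⁻¹' PrimeSpectrum.zeroLocus {MvPolynomial.X e - MvPolynomial.C c} := by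
    ext x
    simp [mem_toSpec, sub_eq_zero]
  rw [hzero]
  exact (PrimeSpectrum.isClosed_zeroLocus _).preimage isInducing_toSpec.continuous

theorem topologicalKrullDim_le_card [Finite E] :
    topologicalKrullDim (ZariskiSpace k E) ≤ Nat.card E := by
  refine isInducing_toSpec.topologicalKrullDim_le.trans ?_
  rw [PrimeSpectrum.topologicalKrullDim_eq_ringKrullDim,
    MvPolynomial.ringKrullDim_of_isNoetherianRing, ringKrullDim_eq_zero_of_field, zero_add]

theorem continuous_extend (F : Set E) (c : E → k) : Continuous (extend F c) := by
  classical
  refine continuous_of_forall_aeval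
    (fun e => if he : e ∈ F then MvPolynomial.X ⟨e, he⟩ else MvPolynomial.C (c e)) fun y e => ?_
  by_cases he : e ∈ F
  · simp [extend_of_mem c y he, he]
  · simp [extend_of_notMem c y he, he]

theorem topologicalKrullDim_le_card_of_forall_notMem [Finite E] {X : Type*} [TopologicalSpace X]
    {f : X → ZariskiSpace k E} (hf : IsInducing f) {F : Set E}
    (h : ∀ e ∉ F, ∃ c, ∀ x, f x e = c) : topologicalKrullDim X ≤ Nat.card F := by
  choose! c hc using h
  let restr : ZariskiSpace k E → ZariskiSpace k F := fun x e => x e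
  have hrestr : Continuous restr :=
    continuous_of_forall_aeval (fun e : F => MvPolynomial.X e.1) (by simp [restr])
  have hleft : extend F c ∘ restr ∘ f = f := by
    refine funext fun x => ext fun e => ?_
    by_cases he : e ∈ F
    · exact extend_of_mem c _ he
    · exact (extend_of_notMem c _ he).trans (hc e he x).symm
  have hind : IsInducing (restr ∘ f) :=
    .of_comp (hrestr.comp hf.continuous) (continuous_extend F c) (by rwa [hleft])
  exact hind.topologicalKrullDim_le.trans topologicalKrullDim_le_card

theorem isIrreducible_box_of_forall_infinite {s : E → Set k} (hs : ∀ e, (s e).Infinite) :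
    IsIrreducible (box s) := by
  refine isIrreducible_of_image isInducing_toSpec ?_
  have hvan : PrimeSpectrum.vanishingIdeal (toSpec '' box s) = ⊥ := by
    refine (Submodule.eq_bot_iff _).2 fun p hp => MvPolynomial.funext_set s hs fun x hx => ?_
    rw [PrimeSpectrum.mem_vanishingIdeal] at hp
    simpa using mem_toSpec.1 (hp _ (Set.mem_image_of_mem _ fun e => hx e trivial))
  rw [PrimeSpectrum.isIrreducible_iff_vanishingIdeal_isPrime, hvan]
  exact Ideal.isPrime_bot

theorem isIrreducible_box {s : E → Set k} (hs : ∀ e, (s e).Infinite ∨ ∃ c, s e = {c}) :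
    IsIrreducible (box s) := by
  choose! c hc using fun e => (hs e).resolve_left
  let F : Set E := {e | (s e).Infinite}
  have hbox : box s = extend F c '' box fun e : F => s e := by
    refine Set.Subset.antisymm (fun x hx => ⟨fun e => x e, fun e => hx e, ext fun e => ?_⟩) ?_
    · by_cases he : e ∈ F
      · exact extend_of_mem c _ he
      · have hx' : x e ∈ ({c e} : Set k) := hc e he ▸ hx e
        exact (extend_of_notMem c _ he).trans hx'.symm
    · rintro _ ⟨y, hy, rfl⟩ e
      by_cases he : e ∈ F
      · exact extend_of_mem c y he ▸ hy ⟨e, he⟩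
      · simp [extend_of_notMem c y he, hc e he]
  rw [hbox]
  exact (isIrreducible_box_of_forall_infinite fun e => e.2).image _
    (continuous_extend F c).continuousOn

theorem topologicalKrullDim_box_le [Finite E] (s : E → Set k) :
    topologicalKrullDim (box s) ≤ Nat.card {e | (s e).Infinite} := by
  refine topologicalKrullDim_le_of_forall_isIrreducible fun Z hZ _ =>
    topologicalKrullDim_le_card_of_forall_notMem
      (IsInducing.subtypeVal.comp IsInducing.subtypeVal) fun e he => ?_
  obtain ⟨c, hc⟩ := exists_eqOn_const_of_isIrreducible hZ (f := fun x => x.1 e)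
    (fun c => (isClosed_setOf_apply_eq e c).preimage continuous_subtype_val)
    ((Set.not_infinite.1 he).subset (Set.image_subset_iff.2 fun x _ => x.2 e))
  exact ⟨c, fun x => hc x.2⟩

theorem card_le_topologicalKrullDim_box [Finite E] {s : E → Set k} (hs : ∀ e, (s e).Nonempty) :
    Nat.card {e | (s e).Infinite} ≤ topologicalKrullDim (box s) := by
  classical
  choose c hc using hs
  let F : Set E := {e | (s e).Infinite}
  let C : Set F → Set (ZariskiSpace k E) := fun T =>
    box ((Subtype.val '' T).piecewise s fun e => {c e})
  have mem_C {T x} : x ∈ C T ↔ x ∈ box s ∧ ∀ e ∉ Subtype.val '' T, x e = c e :=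
    mem_box_piecewise_singleton hc
  have hirr (T) : IsIrreducible (C T) := isIrreducible_box fun e => by
    by_cases he : e ∈ Subtype.val '' T
    · obtain ⟨e, -, rfl⟩ := id he
      rw [Set.piecewise_eq_of_mem _ _ _ he]
      exact .inl e.2
    · exact .inr ⟨c e, Set.piecewise_eq_of_notMem _ _ _ he⟩
  have hclosed (T) : IsClosed (Subtype.val ⁻¹' C T : Set (box s)) := by
    have hC : Subtype.val ⁻¹' C T = ⋂ e ∉ Subtype.val '' T, {x : box s | x.1 e = c e} := by
      ext x
      simp [mem_C]
    rw [hC]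
    exact isClosed_biInter fun e _ => (isClosed_setOf_apply_eq e _).preimage continuous_subtype_val
  refine (natCard_le_krullDim_set F).trans (Order.krullDim_le_of_strictMono
    (fun T => ⟨_, isIrreducible_preimage_val (hirr T) fun x hx => (mem_C.1 hx).1, hclosed T⟩)
    fun T T' hT => ⟨fun x hx => ?_, fun hle => ?_⟩)
  · exact mem_C.2 ⟨x.2, fun e he => (mem_C.1 hx).2 e fun h => he (Set.image_mono hT.1 h)⟩
  · obtain ⟨e, heT', heT⟩ := Set.exists_of_ssubset hT
    obtain ⟨x, hxs, hxe, hxc⟩ := exists_mem_box_apply_ne hc e.2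
    have hx : x ∈ C T' := mem_C.2 ⟨hxs, fun i hi => hxc i fun hie =>
      hi ⟨e, heT', hie.symm⟩⟩
    exact hxe ((mem_C.1 (@hle ⟨x, hxs⟩ hx)).2 e (by simpa using heT))

theorem topologicalKrullDim_box [Finite E] {s : E → Set k} (hs : ∀ e, (s e).Nonempty) :
    topologicalKrullDim (box s) = Nat.card {e | (s e).Infinite} :=
  (topologicalKrullDim_box_le s).antisymm (card_le_topologicalKrullDim_box hs)

end ZariskiSpace

/-! ## Orders of jets -/

section JetRingAlgebra

namespace JetRing

variable {A : Type*} [CommRing A] {m l : ℕ}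

/-- The coefficient of `t^j`, as an additive map. -/
def coeffHom (j : Fin (m + 1)) : JetRing A m →+ A :=
  AddMonoidHom.mk' (fun x => x.coeff j) fun x y => coeff_add x y j

theorem coeff_zero (j : Fin (m + 1)) : (0 : JetRing A m).coeff j = 0 :=
  (coeffHom j).map_zero

theorem coeff_sub (x y : JetRing A m) (j : Fin (m + 1)) :
    (x - y).coeff j = x.coeff j - y.coeff j :=
  (coeffHom j).map_sub x y

theorem coeff_one (j : Fin (m + 1)) : (1 : JetRing A m).coeff j = if j = 0 then 1 else 0 := by
  simpa using coeff_algebraMap (A := A) (m := m) (1 : A) j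

theorem coeff_zero_mul (x y : JetRing A m) : (x * y).coeff 0 = x.coeff 0 * y.coeff 0 := by
  have hpairs : (Finset.univ.filter fun p : Fin (m + 1) × Fin (m + 1) =>
      (p.1 : ℕ) + p.2 = (0 : Fin (m + 1))) = {(0, 0)} := by
    ext ⟨i, j⟩
    simp
  rw [coeff_mul, hpairs, Finset.sum_singleton]

/-- The constant coefficient, as a ring homomorphism. -/
def constCoeff : JetRing A m →+* A where
  toFun x := x.coeff 0
  map_one' := by simp [coeff_one]
  map_mul' := coeff_zero_mul
  map_zero' := coeff_zero 0
  map_add' x y := coeff_add x y 0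

theorem constCoeff_apply (x : JetRing A m) : constCoeff x = x.coeff 0 := rfl

theorem constCoeff_algebraMap (c : A) : constCoeff (algebraMap A (JetRing A m) c) = c := by
  simp [constCoeff_apply, coeff_algebraMap]

theorem coeff_truncHom (f : PowerSeries A) (j : Fin (m + 1)) :
    (truncHom A m f).coeff j = PowerSeries.coeff (j : ℕ) f :=
  coeff_ofCoeff (fun j : Fin (m + 1) => PowerSeries.coeff (j : ℕ) f) j

theorem truncHom_surjective : Function.Surjective (truncHom A m) := by
  intro x
  refine ⟨PowerSeries.mk fun j => if h : j < m + 1 then x.coeff ⟨j, h⟩ else 0, ext fun j => ?_⟩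
  rw [coeff_truncHom, PowerSeries.coeff_mk, dif_pos j.2]

theorem isUnit_of_isUnit_coeff_zero {x : JetRing A m} (hx : IsUnit (x.coeff 0)) : IsUnit x := by
  obtain ⟨f, rfl⟩ := truncHom_surjective x
  refine (PowerSeries.isUnit_iff_constantCoeff.2 ?_).map (truncHom A m)
  simpa [coeff_truncHom] using hx

/-- The ideal `(t^l)` of `A[t]/(t^(m+1))`. -/
def orderIdeal (A : Type*) [CommRing A] (m l : ℕ) : Ideal (JetRing A m) where
  carrier := {x | ∀ j : Fin (m + 1), (j : ℕ) < l → x.coeff j = 0}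
  zero_mem' j _ := coeff_zero j
  add_mem' hx hy j hj := by rw [coeff_add, hx j hj, hy j hj, add_zero]
  smul_mem' c x hx j hj := by
    rw [smul_eq_mul, coeff_mul]
    refine Finset.sum_eq_zero fun p hp => ?_
    have hsum : (p.1 : ℕ) + p.2 = j := (Finset.mem_filter.1 hp).2
    rw [hx p.2 (by lia), mul_zero]

theorem mem_orderIdeal {x : JetRing A m} :
    x ∈ orderIdeal A m l ↔ ∀ j : Fin (m + 1), (j : ℕ) < l → x.coeff j = 0 := Iff.rfl

theorem orderIdeal_antitone : Antitone (orderIdeal A m) :=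
  fun _ _ h _ hx j hj => hx j (hj.trans_le h)

theorem orderIdeal_add_one_eq_bot : orderIdeal A m (m + 1) = ⊥ :=
  (Submodule.eq_bot_iff _).2 fun x hx => ext fun j => by rw [hx j j.2, coeff_zero]

theorem truncHom_mem_orderIdeal (hl : l ≤ m + 1) {f : PowerSeries A} :
    truncHom A m f ∈ orderIdeal A m l ↔ (l : ℕ∞) ≤ f.order := by
  simp only [mem_orderIdeal, coeff_truncHom]
  refine ⟨fun h => PowerSeries.nat_le_order _ _ fun j hj => h ⟨j, by lia⟩ hj, fun h j hj => ?_⟩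
  exact PowerSeries.coeff_of_lt_order _ (lt_of_lt_of_le (by exact_mod_cast hj) h)

theorem truncHom_eq_zero_iff {f : PowerSeries A} :
    truncHom A m f = 0 ↔ ((m + 1 : ℕ) : ℕ∞) ≤ f.order := by
  rw [← truncHom_mem_orderIdeal le_rfl, orderIdeal_add_one_eq_bot, Ideal.mem_bot]

end JetRing

theorem natCast_le_iff_of_truncOrd_eq {m l : ℕ} {e e' : ℕ∞} (h : truncOrd m e = truncOrd m e')
    (hl : l ≤ m + 1) : (l : ℕ∞) ≤ e ↔ (l : ℕ∞) ≤ e' := by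
  have hlt : ∀ {e : ℕ∞}, ¬ e ≤ m → (l : ℕ∞) ≤ e := fun he =>
    (show (l : ℕ∞) ≤ m + 1 by exact_mod_cast hl).trans (Order.add_one_le_of_lt (not_le.1 he))
  unfold truncOrd at h
  split_ifs at h with he he' he'
  · rw [h]
  · exact absurd (h ▸ he) (by simp)
  · exact absurd (h ▸ he') (by simp)
  · exact iff_of_true (hlt he) (hlt he')

namespace JetRing

variable {A : Type*} [CommRing A] {m l : ℕ}

theorem mul_truncHom_eq_zero_iff [NoZeroDivisors A] {x : JetRing A m} {f : PowerSeries A} {e : ℕ}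
    (hf : truncOrd m f.order = truncOrd m e) :
    x * truncHom A m f = 0 ↔ x ∈ orderIdeal A m (m + 1 - e) := by
  obtain ⟨p, rfl⟩ := truncHom_surjective x
  rw [← map_mul, truncHom_eq_zero_iff, PowerSeries.order_mul,
    truncHom_mem_orderIdeal (Nat.sub_le _ _)]
  cases p.order with
  | top => simp
  | coe q =>
    rw [← tsub_le_iff_left, ← ENat.natCast_sub,
      natCast_le_iff_of_truncOrd_eq hf (Nat.sub_le _ _), Nat.cast_le, Nat.cast_le]
    lia

theorem coeff_zero_pow_eq_one {x : JetRing A m} {n : ℕ} (hl : l ≠ 0)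
    (h : x ^ n - 1 ∈ orderIdeal A m l) : x.coeff 0 ^ n = 1 := by
  have hcoeff : constCoeff (x ^ n - 1) = 0 := h 0 (Nat.pos_of_ne_zero hl)
  rwa [map_sub, map_pow, map_one, sub_eq_zero] at hcoeff

theorem coeff_eq_zero_of_pow_sub_one_mem {x : JetRing A m} {n : ℕ} (hn : IsUnit (n : A))
    (h : x ^ n - 1 ∈ orderIdeal A m l) {j : Fin (m + 1)} (hj : j ≠ 0) (hjl : (j : ℕ) < l) :
    x.coeff j = 0 := by
  set c := x.coeff 0 with hc
  have hcn : c ^ n = 1 := coeff_zero_pow_eq_one (by lia) h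
  -- `x^n - c^n` is `x - c` times a jet with constant coefficient `n c^(n-1)`.
  have hunit : IsUnit (∑ i ∈ Finset.range n, x ^ i *
      algebraMap A (JetRing A m) c ^ (n - 1 - i)) := by
    refine isUnit_of_isUnit_coeff_zero ?_
    rw [← constCoeff_apply, map_sum]
    simp only [map_mul, map_pow, constCoeff_algebraMap]
    rw [constCoeff_apply, ← hc, geom_sum₂_self]
    rcases eq_or_ne n 0 with rfl | hn0
    · simpa using hn
    · exact hn.mul ((IsUnit.of_pow_eq_one hcn hn0).pow _)
  have hmem : x - algebraMap A (JetRing A m) c ∈ orderIdeal A m l := by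
    rwa [← Ideal.unit_mul_mem_iff_mem _ hunit, geom_sum₂_mul, ← map_pow, hcn, map_one]
  simpa [coeff_sub, coeff_algebraMap, hj] using hmem j hjl

end JetRing

end JetRingAlgebra

/-! ## Coordinates on the jets of the torus -/

section TorusJets

variable {k : Type*} [CommRing k] {M : Type*} [AddCommGroup M] {ι : Type*}

theorem chi_nsmul (n : ℕ) (u : M) : chi k (n • u) = chi k u ^ n := by
  simp [chi]

theorem exists_algHom_chi_basis_eq {A : Type*} [CommRing A] [Algebra k A]
    (b : Module.Basis ι ℤ M) (x : ι → Aˣ) :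
    ∃ f : AddMonoidAlgebra k M →ₐ[k] A, ∀ i, f (chi k (b i)) = x i := by
  let character : M →ₗ[ℤ] Additive Aˣ := b.constr ℤ fun i => Additive.ofMul (x i)
  refine ⟨ofMonomials (fun u => ((character u).toMul : A)) (by simp) (by simp), fun i => ?_⟩
  simp [character]

theorem algHom_ext_chi_basis {A : Type*} [CommRing A] [Algebra k A] (b : Module.Basis ι ℤ M)
    {f g : AddMonoidAlgebra k M →ₐ[k] A} (h : ∀ i, f (chi k (b i)) = g (chi k (b i))) :
    f = g := by
  let character (φ : AddMonoidAlgebra k M →ₐ[k] A) : M →ₗ[ℤ] Additive Aˣ :=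
    (MonoidHom.toAdditiveRight ((φ : AddMonoidAlgebra k M →* A).comp
      (AddMonoidAlgebra.of k M)).toHomUnits).toIntLinearMap
  have hcharacter : character f = character g :=
    b.ext fun i => Additive.toMul.injective (Units.ext (h i))
  exact algHom_ext_chi fun u =>
    congrArg (fun φ : M →ₗ[ℤ] Additive Aˣ => ((φ u).toMul : A)) hcharacter

theorem coeff_jetEquiv {m : ℕ} {R A : Type*} [CommRing R] [Algebra k R] [CommRing A] [Algebra k A]
    (φ : JetAlgebra k m R →ₐ[k] A) (r : R) (j : Fin (m + 1)) :
    (jetEquiv A φ r).coeff j = φ (jetCoord k m r j) :=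
  JetRing.coeff_ofCoeff _ j

theorem jetEquiv_symm_jetCoord {m : ℕ} {R A : Type*} [CommRing R] [Algebra k R] [CommRing A]
    [Algebra k A] (γ : R →ₐ[k] JetRing A m) (r : R) (j : Fin (m + 1)) :
    (jetEquiv A).symm γ (jetCoord k m r j) = (γ r).coeff j := by
  rw [← coeff_jetEquiv, Equiv.apply_symm_apply]

end TorusJets

namespace JetPoint

variable {k : Type*} [Field k] {m : ℕ} {M : Type*} [AddCommGroup M] {ι : Type*}

theorem isInducing_toSpec {R : Type*} [CommRing R] [Algebra k R] :
    IsInducing (toSpec : JetPoint k m R → PrimeSpectrum (JetAlgebra k m R)) := ⟨rfl⟩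

/-- The coefficients of the values of a jet of the torus on a `ℤ`-basis of the characters: they
identify `T_m` with the open subset of an affine space where no constant coefficient vanishes. -/
def coords (b : Module.Basis ι ℤ M) (g : JetPoint k m (AddMonoidAlgebra k M)) :
    ZariskiSpace k (ι × Fin (m + 1)) :=
  fun e => (g.hom (chi k (b e.1))).coeff e.2

theorem coords_apply (b : Module.Basis ι ℤ M) (g : JetPoint k m (AddMonoidAlgebra k M)) (i : ι)
    (j : Fin (m + 1)) : coords b g (i, j) = (g.hom (chi k (b i))).coeff j := rfl

theorem coords_zero_ne_zero (b : Module.Basis ι ℤ M) (g : JetPoint k m (AddMonoidAlgebra k M))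
    (i : ι) : coords b g (i, 0) ≠ 0 := by
  have hmul : chi k (b i) * chi k (-b i) = 1 := by
    rw [← chi_add, add_neg_cancel, chi_zero]
  have hunit : IsUnit (JetRing.constCoeff (g.hom (chi k (b i)))) :=
    ((IsUnit.of_mul_eq_one _ hmul).map g.hom).map JetRing.constCoeff
  exact hunit.ne_zero

theorem exists_coords_eq (b : Module.Basis ι ℤ M) {x : ZariskiSpace k (ι × Fin (m + 1))}
    (hx : ∀ i, x (i, 0) ≠ 0) : ∃ g, coords b g = x := by
  have hunit (i : ι) : IsUnit (JetRing.ofCoeff fun j => x (i, j)) :=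
    JetRing.isUnit_of_isUnit_coeff_zero (by simpa using hx i)
  obtain ⟨f, hf⟩ := exists_algHom_chi_basis_eq (k := k) b fun i => (hunit i).unit
  refine ⟨⟨f⟩, ZariskiSpace.ext fun e => ?_⟩
  simp [coords, hf]

theorem continuous_coords (b : Module.Basis ι ℤ M) :
    Continuous (coords b : JetPoint k m (AddMonoidAlgebra k M) → _) := by
  let α : MvPolynomial (ι × Fin (m + 1)) k →ₐ[k] JetAlgebra k m (AddMonoidAlgebra k M) :=
    MvPolynomial.aeval fun e => jetCoord k m (chi k (b e.1)) e.2
  have hα (g : JetPoint k m (AddMonoidAlgebra k M)) :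
      ((jetEquiv k).symm g.hom).comp α = MvPolynomial.aeval fun e => coords b g e :=
    MvPolynomial.algHom_ext fun e => by
      simp only [α, AlgHom.comp_apply, MvPolynomial.aeval_X, jetEquiv_symm_jetCoord]
      rfl
  have hcomap : ZariskiSpace.toSpec ∘ coords b = PrimeSpectrum.comap α.toRingHom ∘ toSpec := by
    refine funext fun g => PrimeSpectrum.ext (Ideal.ext fun q => ZariskiSpace.mem_toSpec.trans ?_)
    rw [← hα]
    rfl
  rw [ZariskiSpace.isInducing_toSpec.continuous_iff, hcomap]
  exact (PrimeSpectrum.continuous_comap _).comp isInducing_toSpec.continuous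

/-- The multiplicative set of monomials in the coordinates that are constant coefficients. The
localization at it is the ring of functions on `T_m`. -/
def constCoordMonomials (k : Type*) [CommRing k] (m : ℕ) (ι : Type*) :
    Submonoid (MvPolynomial (ι × Fin (m + 1)) k) :=
  Submonoid.closure (Set.range fun i => MvPolynomial.X (i, 0))

theorem isUnit_aeval_coords (b : Module.Basis ι ℤ M) (g : JetPoint k m (AddMonoidAlgebra k M))
    (p : constCoordMonomials k m ι) :
    IsUnit (MvPolynomial.aeval (fun e => coords b g e) (p : MvPolynomial _ k)) := by
  have hle : constCoordMonomials k m ι ≤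
      (IsUnit.submonoid k).comap (MvPolynomial.aeval fun e => coords b g e) := by
    refine Submonoid.closure_le.2 ?_
    rintro _ ⟨i, rfl⟩
    simpa [IsUnit.mem_submonoid_iff] using coords_zero_ne_zero b g i
  exact hle p.2

theorem exists_universalJet (b : Module.Basis ι ℤ M) :
    ∃ f : AddMonoidAlgebra k M →ₐ[k] JetRing (Localization (constCoordMonomials k m ι)) m,
      ∀ i j, (f (chi k (b i))).coeff j = algebraMap _ _ (MvPolynomial.X (R := k) (i, j)) := by
  let x (i : ι) : JetRing (Localization (constCoordMonomials k m ι)) m :=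
    JetRing.ofCoeff fun j => algebraMap _ _ (MvPolynomial.X (R := k) (i, j))
  have hunit (i : ι) : IsUnit (x i) := by
    refine JetRing.isUnit_of_isUnit_coeff_zero ?_
    rw [JetRing.coeff_ofCoeff]
    exact IsLocalization.map_units _
      (⟨_, Submonoid.subset_closure ⟨i, rfl⟩⟩ : constCoordMonomials k m ι)
  obtain ⟨f, hf⟩ := exists_algHom_chi_basis_eq (k := k) b fun i => (hunit i).unit
  exact ⟨f, fun i j => by simp [hf, x]⟩

theorem exists_toSpec_eq_comap (b : Module.Basis ι ℤ M) :
    ∃ Φ : JetAlgebra k m (AddMonoidAlgebra k M) →ₐ[k] Localization (constCoordMonomials k m ι),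
      ∀ g : JetPoint k m (AddMonoidAlgebra k M), ∃ p,
        g.toSpec = PrimeSpectrum.comap Φ.toRingHom p ∧
        (coords b g).toSpec = PrimeSpectrum.comap (algebraMap _ _) p := by
  obtain ⟨f, hf⟩ := exists_universalJet (k := k) (m := m) b
  refine ⟨(jetEquiv _).symm f, fun g => ?_⟩
  let eval : Localization (constCoordMonomials k m ι) →ₐ[k] k :=
    IsLocalization.liftAlgHom (M := constCoordMonomials k m ι) (isUnit_aeval_coords b g)
  have heval (q : MvPolynomial (ι × Fin (m + 1)) k) :
      eval (algebraMap _ _ q) = MvPolynomial.aeval (fun e => coords b g e) q :=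
    IsLocalization.lift_eq _ q
  have hcomp : eval.comp ((jetEquiv _).symm f) = (jetEquiv k).symm g.hom := by
    refine (Equiv.eq_symm_apply _).2 (algHom_ext_chi_basis b fun i => JetRing.ext fun j => ?_)
    rw [coeff_jetEquiv, AlgHom.comp_apply, jetEquiv_symm_jetCoord, hf, heval,
      MvPolynomial.aeval_X, coords_apply]
  refine ⟨⟨RingHom.ker eval, RingHom.ker_isPrime _⟩, ?_, ?_⟩
  · refine PrimeSpectrum.ext (Ideal.ext fun q => ?_)
    change (jetEquiv k).symm g.hom q = 0 ↔ eval ((jetEquiv _).symm f q) = 0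
    rw [← hcomp, AlgHom.comp_apply]
  · refine PrimeSpectrum.ext (Ideal.ext fun q => ZariskiSpace.mem_toSpec.trans ?_)
    change _ ↔ eval (algebraMap _ _ q) = 0
    rw [heval]

theorem isInducing_coords (b : Module.Basis ι ℤ M) :
    IsInducing (coords b : JetPoint k m (AddMonoidAlgebra k M) → _) := by
  obtain ⟨Φ, hΦ⟩ := exists_toSpec_eq_comap (k := k) (m := m) b
  choose p hp hcoords using hΦ
  have hlocal := PrimeSpectrum.localization_comap_isInducing
    (Localization (constCoordMonomials k m ι)) (constCoordMonomials k m ι)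
  have hcomp : PrimeSpectrum.comap (algebraMap _ _) ∘ p = ZariskiSpace.toSpec ∘ coords b :=
    funext fun g => (hcoords g).symm
  have hpc : Continuous p := by
    rw [hlocal.continuous_iff, hcomp]
    exact ZariskiSpace.isInducing_toSpec.continuous.comp (continuous_coords b)
  have hpind : IsInducing p := by
    refine .of_comp hpc (PrimeSpectrum.continuous_comap Φ.toRingHom) ?_
    rw [show PrimeSpectrum.comap Φ.toRingHom ∘ p = toSpec from funext fun g => (hp g).symm]
    exact isInducing_toSpec
  rw [← ZariskiSpace.isInducing_toSpec.of_comp_iff, ← hcomp]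
  exact hlocal.comp hpind

end JetPoint

/-! ## The stabilizer and its dimension -/

section Congruences

variable {k : Type*} [Field k] {m : ℕ} {M : Type*} [AddCommGroup M]

/-- The characters on which a jet of the torus is congruent to `1` modulo an ideal. -/
def JetPoint.congruentOne (g : JetPoint k m (AddMonoidAlgebra k M)) (I : Ideal (JetRing k m)) :
    Submodule ℤ M :=
  AddSubgroup.toIntSubmodule
    { carrier := {u | g.hom (chi k u) - 1 ∈ I}
      zero_mem' := by simp [chi_zero]
      add_mem' := fun {u v} hu hv => by
        have hmul : g.hom (chi k (u + v)) - 1 =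
            g.hom (chi k u) * (g.hom (chi k v) - 1) + (g.hom (chi k u) - 1) := by
          rw [chi_add, map_mul]; ring
        exact Set.mem_ofPred_eq ▸ hmul ▸ add_mem (I.mul_mem_left _ hv) hu
      neg_mem' := fun {u} hu => by
        have hinv : g.hom (chi k (-u)) * g.hom (chi k u) = 1 := by
          rw [← map_mul, ← chi_add, neg_add_cancel, chi_zero, map_one]
        have hmul : g.hom (chi k (-u)) - 1 = -g.hom (chi k (-u)) * (g.hom (chi k u) - 1) := by
          linear_combination hinv
        exact Set.mem_ofPred_eq ▸ hmul ▸ I.mul_mem_left _ hu }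

theorem JetPoint.mem_congruentOne {g : JetPoint k m (AddMonoidAlgebra k M)}
    {I : Ideal (JetRing k m)} {u : M} : u ∈ g.congruentOne I ↔ g.hom (chi k u) - 1 ∈ I := Iff.rfl

theorem JetPoint.congruentOne_mono (g : JetPoint k m (AddMonoidAlgebra k M)) :
    Monotone g.congruentOne :=
  fun _ _ hIJ _ hu => hIJ hu

theorem JetPoint.mem_stabilizer_toJet_iff {S : AddSubmonoid M}
    (g : JetPoint k m (AddMonoidAlgebra k M)) (δ : ArcPoint k (AddMonoidAlgebra k S)) :
    g ∈ MulAction.stabilizer (JetPoint k m (AddMonoidAlgebra k M)) (δ.toJet m) ↔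
      ∀ u : S, (g.hom (chi k (u : M)) - 1) * truncHom k m (δ (chi k u)) = 0 := by
  have htoJet (u : S) : truncHom k m (δ (chi k u)) = (δ.toJet m).hom (chi k u) := rfl
  simp only [sub_mul, one_mul, sub_eq_zero, htoJet, ← smul_chi, MulAction.mem_stabilizer_iff]
  exact ⟨fun h u => by rw [h], ext_chi⟩

/-- The jets of the torus that are congruent to `1` modulo `t^(m+1-ht u)` on each `u ∈ T`. For
`T = M ∩ σ^∨` and `ht u = ⟨a, u⟩` this is the stabilizer of an element of `T_{m,a}`. The truncated
subtraction makes the condition empty when `ht u > m`. -/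
def congruenceLocus (k : Type*) [Field k] (m : ℕ) (ht : M → ℕ) (T : Set M) :
    Set (JetPoint k m (AddMonoidAlgebra k M)) :=
  {g | ∀ u ∈ T, u ∈ g.congruentOne (JetRing.orderIdeal k m (m + 1 - ht u))}

theorem mem_congruenceLocus {ht : M → ℕ} {T : Set M} {g : JetPoint k m (AddMonoidAlgebra k M)} :
    g ∈ congruenceLocus k m ht T ↔
      ∀ u ∈ T, u ∈ g.congruentOne (JetRing.orderIdeal k m (m + 1 - ht u)) := Iff.rfl

/-- The height of a character `u`, the integer `⟨a, u⟩`, as a natural number. The value is junk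
unless `⟨a, u⟩` is nonnegative, as it is for `u ∈ M ∩ σ^∨` when `a ∈ σ`. -/
def evalHeight {N : Type*} [AddCommGroup N] (a : N) (u : Module.Dual ℤ N) : ℕ := (u a).toNat

theorem stabilizer_eq_congruenceLocus {N : Type*} [AddCommGroup N]
    {σ : PointedCone ℝ (ℝ ⊗[ℤ] N)} {a : N}
    {γ : JetPoint k m (AddMonoidAlgebra k (dualMonoid σ))} (hγ : γ ∈ jetOrbit k σ m a) :
    (MulAction.stabilizer (JetPoint k m (AddMonoidAlgebra k (Module.Dual ℤ N))) γ : Set _) =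
      congruenceLocus k m (evalHeight a) (dualMonoid σ) := by
  obtain ⟨δ, -, rfl, hδ⟩ := hγ
  ext g
  rw [SetLike.mem_coe, JetPoint.mem_stabilizer_toJet_iff, mem_congruenceLocus]
  simp only [JetRing.mul_truncHom_eq_zero_iff (hδ _), JetPoint.mem_congruentOne, SetLike.forall,
    SetLike.mem_coe, evalHeight]

end Congruences

section Dimension

variable {k : Type*} [Field k] {m : ℕ} {M : Type*} [AddCommGroup M] {ι : Type*}

theorem JetPoint.basis_mem_congruentOne_iff (b : Module.Basis ι ℤ M)
    {g : JetPoint k m (AddMonoidAlgebra k M)} {i : ι} {l : ℕ} :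
    b i ∈ g.congruentOne (JetRing.orderIdeal k m l) ↔
      ∀ j : Fin (m + 1), (j : ℕ) < l → coords b g (i, j) = if j = 0 then 1 else 0 := by
  simp only [mem_congruentOne, JetRing.mem_orderIdeal, JetRing.coeff_sub, JetRing.coeff_one,
    sub_eq_zero]
  rfl

/-- The coefficients, on basis characters of weights `w`, on which the stabilizer of a jet puts no
constraint. -/
def freeCoeffs (w : ι → ℕ) (m : ℕ) : Set (ι × Fin (m + 1)) := {e | m + 1 ≤ e.2 + w e.1}

theorem mem_freeCoeffs {w : ι → ℕ} {i : ι} {j : Fin (m + 1)} :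
    (i, j) ∈ freeCoeffs w m ↔ m + 1 ≤ j + w i := Iff.rfl

theorem card_freeCoeffs [Fintype ι] (w : ι → ℕ) (m : ℕ) :
    Nat.card (freeCoeffs w m) = ∑ i, min (w i) (m + 1) := by
  classical
  have hcard (n : ℕ) : (Finset.univ.filter fun j : Fin (m + 1) => m + 1 ≤ j + n).card =
      min n (m + 1) := by
    rw [min_comm, ← Fin.card_filter_val_lt, ← Finset.card_map Fin.revPerm.toEmbedding]
    congr 1
    ext j
    simp only [Finset.mem_map_equiv, Finset.mem_filter_univ, Fin.revPerm_symm, Fin.revPerm_apply,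
      Fin.val_rev]
    lia
  rw [Nat.card_eq_fintype_card, Fintype.card_subtype, Finset.card_filter, Fintype.sum_prod_type]
  simp only [mem_freeCoeffs, ← Finset.card_filter, hcard]

theorem sum_min_le_topologicalKrullDim [Infinite k] [Fintype ι] (b : Module.Basis ι ℤ M) (w : ι → ℕ)
    {H : Set (JetPoint k m (AddMonoidAlgebra k M))}
    (hH : ∀ g : JetPoint k m (AddMonoidAlgebra k M),
      (∀ i, b i ∈ g.congruentOne (JetRing.orderIdeal k m (m + 1 - w i))) → g ∈ H) :
    (∑ i, min (w i) (m + 1) : ℕ) ≤ topologicalKrullDim H := by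
  classical
  let s : ι × Fin (m + 1) → Set k := (freeCoeffs w m).piecewise
    (fun e => if e.2 = 0 then {0}ᶜ else Set.univ) fun e => {if e.2 = 0 then 1 else 0}
  have hzero (i : ι) : s (i, 0) ⊆ {0}ᶜ := by
    by_cases h : (i, (0 : Fin (m + 1))) ∈ freeCoeffs w m <;> simp [s, h]
  have hfree (e) : (s e).Infinite ↔ e ∈ freeCoeffs w m := by
    by_cases h : e ∈ freeCoeffs w m
    · by_cases h0 : e.2 = 0 <;>
        simp [s, h, h0, Set.infinite_univ, (Set.finite_singleton (0 : k)).infinite_compl]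
    · simp [s, h]
  have hnonempty (e) : (s e).Nonempty := by
    by_cases h : e ∈ freeCoeffs w m
    · exact ((hfree e).2 h).nonempty
    · simp [s, h]
  have hsub : ZariskiSpace.box s ⊆ JetPoint.coords b '' H := by
    intro x hx
    obtain ⟨g, rfl⟩ := JetPoint.exists_coords_eq b fun i => hzero i (hx (i, 0))
    refine ⟨g, hH g fun i => (JetPoint.basis_mem_congruentOne_iff b).2 fun j hj => ?_, rfl⟩
    have hij : (i, j) ∉ freeCoeffs w m := by rw [mem_freeCoeffs]; lia
    simpa [s, hij] using hx (i, j)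
  have hbox := ZariskiSpace.topologicalKrullDim_box hnonempty
  simp only [hfree, Set.ofPred_mem_eq, card_freeCoeffs] at hbox
  exact hbox.ge.trans (topologicalKrullDim_le_of_subset_image (JetPoint.isInducing_coords b) hsub)

theorem topologicalKrullDim_le_sum_min [CharZero k] [Fintype ι] (b : Module.Basis ι ℤ M)
    (w : ι → ℕ) {n : ι → ℕ} (hn : ∀ i, n i ≠ 0) {H : Set (JetPoint k m (AddMonoidAlgebra k M))}
    (hH : ∀ g ∈ H, ∀ i, n i • b i ∈ g.congruentOne (JetRing.orderIdeal k m (m + 1 - w i))) :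
    topologicalKrullDim H ≤ (∑ i, min (w i) (m + 1) : ℕ) := by
  classical
  let s : ι × Fin (m + 1) → Set k := (freeCoeffs w m).piecewise (fun _ => Set.univ)
    fun e => if e.2 = 0 then {c | c ^ n e.1 = 1} else {0}
  have hroots (i : ι) : {c : k | c ^ n i = 1}.Finite :=
    (Polynomial.nthRootsFinset (n i) (1 : k)).finite_toSet.subset fun c hc =>
      (Polynomial.mem_nthRootsFinset (Nat.pos_of_ne_zero (hn i)) 1).2 hc
  have hfree (e) : (s e).Infinite ↔ e ∈ freeCoeffs w m := by
    by_cases h : e ∈ freeCoeffs w m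
    · simp [s, h, Set.infinite_univ]
    · by_cases h0 : e.2 = 0 <;> simp [s, h, h0, hroots]
  have hnonempty (e) : (s e).Nonempty := by
    by_cases h : e ∈ freeCoeffs w m
    · exact ((hfree e).2 h).nonempty
    · by_cases h0 : e.2 = 0
      · exact ⟨1, by simp [s, h, h0]⟩
      · simp [s, h, h0]
  have hmaps : Set.MapsTo (JetPoint.coords b) H (ZariskiSpace.box s) := by
    rintro g hg ⟨i, j⟩
    by_cases h : (i, j) ∈ freeCoeffs w m
    · simp [s, h]
    · have hj : (j : ℕ) < m + 1 - w i := by rw [mem_freeCoeffs] at h; lia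
      have hpow := JetPoint.mem_congruentOne.1 (hH g hg i)
      rw [chi_nsmul, map_pow] at hpow
      rcases eq_or_ne j 0 with rfl | h0
      · simpa [s, h, JetPoint.coords_apply] using JetRing.coeff_zero_pow_eq_one (by lia) hpow
      · simpa [s, h, h0, JetPoint.coords_apply] using JetRing.coeff_eq_zero_of_pow_sub_one_mem
          (Nat.cast_ne_zero.2 (hn i)).isUnit hpow h0 hj
  have hbox := ZariskiSpace.topologicalKrullDim_box hnonempty
  simp only [hfree, Set.ofPred_mem_eq, card_freeCoeffs] at hbox
  exact (topologicalKrullDim_le_of_mapsTo (JetPoint.isInducing_coords b) hmaps).trans hbox.le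

end Dimension

/-! ## Bases adapted to a filtration -/

section Lattice

variable {R M ι : Type*} [CommRing R] [AddCommGroup M] [Module R M]

/-- The elements of `M` with a nonzero multiple in `P`: when `R` is a domain, the smallest submodule
containing `P` with torsion-free quotient. -/
def saturation (P : Submodule R M) : Submodule R M := (Submodule.torsion R (M ⧸ P)).comap P.mkQ

theorem mem_saturation_iff [IsDomain R] {P : Submodule R M} {u : M} :
    u ∈ saturation P ↔ ∃ c : R, c ≠ 0 ∧ c • u ∈ P := by
  simp [saturation, ← Submodule.Quotient.mk_smul, Submodule.Quotient.mk_eq_zero,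
    Submonoid.smul_def]

theorem le_saturation [IsDomain R] (P : Submodule R M) : P ≤ saturation P :=
  fun u hu => mem_saturation_iff.2 ⟨1, one_ne_zero, by rwa [one_smul]⟩

theorem saturation_mono [IsDomain R] : Monotone (saturation : Submodule R M → Submodule R M) :=
  fun _ _ h _ hu =>
    let ⟨c, hc, hcu⟩ := mem_saturation_iff.1 hu
    mem_saturation_iff.2 ⟨c, hc, h hcu⟩

theorem saturation_comap_subtype [IsDomain R] (P Q : Submodule R M) :
    saturation (P.comap Q.subtype) = (saturation P).comap Q.subtype := by
  ext u
  simp [mem_saturation_iff]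

instance isTorsionFree_quotient_saturation [IsDomain R] (P : Submodule R M) :
    Module.IsTorsionFree R (M ⧸ saturation P) := by
  rw [Module.isTorsionFree_iff_smul_eq_zero]
  intro c x hx
  obtain ⟨u, rfl⟩ := Submodule.Quotient.mk_surjective _ x
  rw [← Submodule.Quotient.mk_smul, Submodule.Quotient.mk_eq_zero] at hx
  obtain ⟨d, hd, hdu⟩ := mem_saturation_iff.1 hx
  refine or_iff_not_imp_left.2 fun hc => (Submodule.Quotient.mk_eq_zero _).2 ?_
  exact mem_saturation_iff.2 ⟨d * c, mul_ne_zero hd hc, by rwa [mul_smul]⟩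

/-- The basis `b`, with weights `w`, is adapted to the filtration `F`: up to saturation, the step
`F j` is spanned by the basis vectors of weight at most `j`. -/
def IsAdapted (F : ℕ → Submodule R M) (b : Module.Basis ι R M) (w : ι → ℕ) : Prop :=
  ∀ j, saturation (F j) = Submodule.span R (b '' {i | w i ≤ j})

namespace IsAdapted

variable {F : ℕ → Submodule R M} {b : Module.Basis ι R M} {w : ι → ℕ}

theorem weight_le_of_repr_ne_zero (h : IsAdapted F b w) {j : ℕ} {u : M}
    (hu : u ∈ saturation (F j)) {i : ι} (hi : b.repr u i ≠ 0) : w i ≤ j := by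
  rw [h j, Module.Basis.mem_span_image] at hu
  exact hu (Finsupp.mem_support_iff.2 hi)

theorem weight_le_of_mem [Nontrivial R] (h : IsAdapted F b w) {j : ℕ} {i : ι}
    (hi : b i ∈ saturation (F j)) : w i ≤ j :=
  h.weight_le_of_repr_ne_zero hi (by simp)

theorem basis_mem_saturation (h : IsAdapted F b w) (i : ι) : b i ∈ saturation (F (w i)) :=
  h (w i) ▸ Submodule.subset_span ⟨i, show w i ≤ w i from le_rfl, rfl⟩

theorem reindex (h : IsAdapted F b w) {ι' : Type*} (e : ι ≃ ι') :
    IsAdapted F (b.reindex e) (w ∘ e.symm) := by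
  intro j
  rw [h j, Module.Basis.coe_reindex, Set.image_comp]
  congr 2
  ext i
  simp

theorem sumQuot [IsDomain R] {κ : Type*} {J : ℕ} {b : Module.Basis ι R (saturation (F J))}
    (hF : Monotone F) (hJ : saturation (F (J + 1)) = ⊤)
    (h : IsAdapted (fun j => (F j).comap (saturation (F J)).subtype) b w)
    (bQ : Module.Basis κ R (M ⧸ saturation (F J))) :
    IsAdapted F (b.sumQuot bQ) (Sum.elim w fun _ => J + 1) := by
  intro j
  rcases Nat.lt_or_ge J j with hj | hj
  · have hw (i : ι) : w i ≤ J := h.weight_le_of_mem (by simp [saturation_comap_subtype])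
    have huniv : {i : ι ⊕ κ | Sum.elim w (fun _ => J + 1) i ≤ j} = Set.univ := by
      ext (i | i)
      · simpa using (hw i).trans hj.le
      · simpa using hj
    rw [huniv, Set.image_univ, Module.Basis.span_eq, eq_top_iff, ← hJ]
    exact saturation_mono (hF hj)
  · have hinl : {i : ι ⊕ κ | Sum.elim w (fun _ => J + 1) i ≤ j} = Sum.inl '' {i | w i ≤ j} := by
      ext (i | i)
      · simp
      · simp only [Set.mem_ofPred_eq, Sum.elim_inr, Set.mem_image, reduceCtorEq, and_false,
          exists_false, iff_false]
        lia
    have hmap := congrArg (Submodule.map (saturation (F J)).subtype) (h j)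
    rw [saturation_comap_subtype, Submodule.map_comap_subtype,
      inf_eq_right.2 (saturation_mono (hF hj)), Submodule.map_span, Set.image_image] at hmap
    rw [hmap, hinl, Set.image_image]
    simp

end IsAdapted

theorem exists_isAdapted [IsDomain R] [IsPrincipalIdealRing R] (J : ℕ) :
    ∀ {M : Type*} [AddCommGroup M] [Module R M] [Module.Free R M] [Module.Finite R M]
      {F : ℕ → Submodule R M}, Monotone F → saturation (F J) = ⊤ →
      ∃ (b : Module.Basis (Fin (Module.finrank R M)) R M) (w : Fin (Module.finrank R M) → ℕ),
        IsAdapted F b w := by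
  induction J with
  | zero =>
    intro M _ _ _ _ F hF hJ
    refine ⟨Module.finBasis R M, 0, fun j => ?_⟩
    rw [eq_top_iff.2 (hJ.ge.trans (saturation_mono (hF (Nat.zero_le j))))]
    simp [(Module.finBasis R M).span_eq]
  | succ J ih =>
    intro M _ _ _ _ F hF hJ
    obtain ⟨b, w, hbw⟩ := ih (F := fun j => (F j).comap (saturation (F J)).subtype)
      (fun i j hij => Submodule.comap_mono (hF hij)) (by simp [saturation_comap_subtype])
    have hadapted := hbw.sumQuot hF hJ (Module.finBasis R (M ⧸ saturation (F J)))
    let e := Fintype.equivFinOfCardEq (Module.finrank_eq_card_basis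
      (b.sumQuot (Module.finBasis R (M ⧸ saturation (F J))))).symm
    exact ⟨_, _, hadapted.reindex e⟩

end Lattice

section Determinants

variable {R M ι : Type*} [CommRing R] [AddCommGroup M] [Module R M] [Fintype ι] [DecidableEq ι]

theorem exists_perm_repr_ne_zero (b : Module.Basis ι R M) {v : ι → M} (hv : b.det v ≠ 0) :
    ∃ π : Equiv.Perm ι, ∀ i, b.repr (v i) (π i) ≠ 0 := by
  rw [Module.Basis.det_apply, Matrix.det_apply] at hv
  obtain ⟨π, -, hπ⟩ := Finset.exists_ne_zero_of_sum_ne_zero hv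
  refine ⟨π, fun i hi => hπ ?_⟩
  rw [Finset.prod_eq_zero (Finset.mem_univ i) hi, smul_zero]

theorem exists_mem_det_update_ne_zero [IsDomain R] (b : Module.Basis ι R M) {v : ι → M}
    (hv : b.det v ≠ 0) {i : ι} {T : Set M} (hT : v i ∈ saturation (Submodule.span R T)) :
    ∃ u ∈ T, b.det (Function.update v i u) ≠ 0 := by
  by_contra! hzero
  let f : M →ₗ[R] R := b.det.toMultilinearMap.toLinearMap v i
  have hspan : Submodule.span R T ≤ LinearMap.ker f := Submodule.span_le.2 hzero
  obtain ⟨c, hc, hcv⟩ := mem_saturation_iff.1 hT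
  have hfv : f (v i) = b.det v := congrArg b.det (Function.update_eq_self i v)
  have hker := LinearMap.mem_ker.1 (hspan hcv)
  rw [map_smul, hfv, smul_eq_mul] at hker
  exact mul_ne_zero hc hv hker

theorem exists_det_ne_zero_of_mem_saturation [IsDomain R] (b : Module.Basis ι R M) {T : ι → Set M}
    (hT : ∀ i, b i ∈ saturation (Submodule.span R (T i))) :
    ∃ v : ι → M, (∀ i, v i ∈ T i) ∧ b.det v ≠ 0 := by
  suffices h : ∀ s : Finset ι, ∃ v : ι → M,
      (∀ i ∈ s, v i ∈ T i) ∧ (∀ i ∉ s, v i = b i) ∧ b.det v ≠ 0 by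
    obtain ⟨v, hvT, -, hv⟩ := h Finset.univ
    exact ⟨v, fun i => hvT i (Finset.mem_univ i), hv⟩
  intro s
  induction s using Finset.induction_on with
  | empty => exact ⟨b, by simp, by simp, by simp [b.det_self]⟩
  | insert i s hi ih =>
    obtain ⟨v, hvT, hvb, hv⟩ := ih
    obtain ⟨u, hu, hdet⟩ := exists_mem_det_update_ne_zero b hv (hvb i hi ▸ hT i)
    refine ⟨Function.update v i u, fun j hj => ?_, fun j hj => ?_, hdet⟩
    · rcases eq_or_ne j i with rfl | hji
      · simpa using hu
      · rw [Function.update_of_ne hji]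
        exact hvT j (Finset.mem_of_mem_insert_of_ne hj hji)
    · rw [Finset.mem_insert, not_or] at hj
      rw [Function.update_of_ne hj.1]
      exact hvb j hj.2

theorem span_one_tmul_eq_top_iff_det_ne_zero (K : Type*) [Field K] [Algebra R K] [FaithfulSMul R K]
    (b : Module.Basis ι R M) (v : ι → M) :
    Submodule.span K (Set.range fun i => (1 : K) ⊗ₜ[R] v i) = ⊤ ↔ b.det v ≠ 0 := by
  have hdet : (b.baseChange K).det (fun i => (1 : K) ⊗ₜ[R] v i) = algebraMap R K (b.det v) := by
    rw [Module.Basis.det_apply, Module.Basis.det_apply, RingHom.map_det]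
    congr 1
    ext i j
    simp [Module.Basis.toMatrix_apply, Module.Basis.baseChange_repr_tmul, Algebra.smul_def]
  rw [← map_ne_zero_iff _ (FaithfulSMul.algebraMap_injective R K), ← hdet, ← isUnit_iff_ne_zero,
    ← Module.Basis.is_basis_iff_det]
  refine ⟨fun h => ⟨linearIndependent_of_top_le_span_of_card_eq_finrank h.ge ?_, h⟩, And.right⟩
  rw [Module.finrank_eq_card_basis (b.baseChange K)]

end Determinants

section WeightFiltration

variable (R : Type*) {M ι : Type*} [CommRing R] [AddCommGroup M] [Module R M]

/-- The filtration of `M` by the height function `ht` on `T`: its `j`-th step is spanned by the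
elements of `T` of height at most `j`. -/
def heightSpan (ht : M → ℕ) (T : Set M) (j : ℕ) : Submodule R M :=
  Submodule.span R {u ∈ T | ht u ≤ j}

variable {R} {ht : M → ℕ} {T : Set M}

theorem mem_heightSpan {u : M} {j : ℕ} (hu : u ∈ T) (hj : ht u ≤ j) : u ∈ heightSpan R ht T j :=
  Submodule.subset_span ⟨hu, hj⟩

theorem heightSpan_mono : Monotone (heightSpan R ht T) :=
  fun _ _ hij => Submodule.span_mono fun _ hu => ⟨hu.1, hu.2.trans hij⟩

theorem exists_heightSpan_eq_top [IsNoetherian R M] (hT : Submodule.span R T = ⊤) :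
    ∃ J, heightSpan R ht T J = ⊤ := by
  obtain ⟨J, hJ⟩ := monotone_stabilizes_iff_noetherian.2 ‹IsNoetherian R M›
    ⟨heightSpan R ht T, heightSpan_mono⟩
  refine ⟨J, eq_top_iff.2 (hT ▸ Submodule.span_le.2 fun u hu => ?_)⟩
  exact (hJ _ (le_max_left J (ht u))).ge (mem_heightSpan hu (le_max_right _ _))

theorem heightSpan_closure
    (hadd : ∀ u ∈ AddSubmonoid.closure T, ∀ v ∈ AddSubmonoid.closure T, ht u ≤ ht (u + v)) :
    heightSpan R ht (AddSubmonoid.closure T : Set M) = heightSpan R ht T := by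
  refine funext fun j => le_antisymm (Submodule.span_le.2 ?_) ?_
  · rintro u ⟨hu, huj⟩
    refine heightSpan_mono huj ?_
    clear huj
    induction hu using AddSubmonoid.closure_induction with
    | mem u hu => exact mem_heightSpan hu le_rfl
    | zero => exact zero_mem _
    | add u v hu hv ihu ihv =>
      exact add_mem (heightSpan_mono (hadd u hu v hv) ihu)
        (heightSpan_mono (add_comm v u ▸ hadd v hv u hu) ihv)
  · exact Submodule.span_mono fun u hu => ⟨AddSubmonoid.subset_closure hu.1, hu.2⟩

namespace IsAdapted

variable [Fintype ι] [DecidableEq ι] [IsDomain R] {b : Module.Basis ι R M} {w : ι → ℕ}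

theorem sum_le_sum_of_det_ne_zero (h : IsAdapted (heightSpan R ht T) b w) {v : ι → M}
    (hvT : ∀ i, v i ∈ T) (hv : b.det v ≠ 0) : ∑ i, w i ≤ ∑ i, ht (v i) := by
  obtain ⟨π, hπ⟩ := exists_perm_repr_ne_zero b hv
  rw [← Equiv.sum_comp π w]
  exact Finset.sum_le_sum fun i _ =>
    h.weight_le_of_repr_ne_zero (le_saturation _ (mem_heightSpan (hvT i) le_rfl)) (hπ i)

theorem exists_det_ne_zero_height_eq (h : IsAdapted (heightSpan R ht T) b w) :
    ∃ v : ι → M, (∀ i, v i ∈ T) ∧ (∀ i, ht (v i) = w i) ∧ b.det v ≠ 0 := by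
  obtain ⟨v, hv, hdet⟩ := exists_det_ne_zero_of_mem_saturation b h.basis_mem_saturation
  have hle : ∀ i ∈ Finset.univ, ht (v i) ≤ w i := fun i _ => (hv i).2
  have hsum := (Finset.sum_le_sum hle).antisymm
    (h.sum_le_sum_of_det_ne_zero (fun i => (hv i).1) hdet)
  exact ⟨v, fun i => (hv i).1,
    fun i => (Finset.sum_eq_sum_iff_of_le hle).1 hsum i (Finset.mem_univ i), hdet⟩

end IsAdapted

theorem IsAdapted.topologicalKrullDim_congruenceLocus {k : Type*} [Field k] [CharZero k] {m : ℕ}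
    {M : Type*} [AddCommGroup M] {ht : M → ℕ} {T : Set M} [Fintype ι] {b : Module.Basis ι ℤ M}
    {w : ι → ℕ} (h : IsAdapted (heightSpan ℤ ht T) b w) :
    topologicalKrullDim (congruenceLocus k m ht T) = (∑ i, min (w i) (m + 1) : ℕ) := by
  have hmono (g : JetPoint k m (AddMonoidAlgebra k M)) :
      Monotone fun j => g.congruentOne (JetRing.orderIdeal k m (m + 1 - j)) := fun i j hij =>
    g.congruentOne_mono (JetRing.orderIdeal_antitone (Nat.sub_le_sub_left hij _))
  refine le_antisymm ?_ (sum_min_le_topologicalKrullDim b w fun g hg u hu => ?_)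
  · choose c hc hcb using fun i => mem_saturation_iff.1 (h.basis_mem_saturation i)
    refine topologicalKrullDim_le_sum_min b w (fun i => Int.natAbs_ne_zero.2 (hc i))
      fun g hg i => ?_
    have hle : heightSpan ℤ ht T (w i) ≤
        g.congruentOne (JetRing.orderIdeal k m (m + 1 - w i)) :=
      Submodule.span_le.2 fun u hu => hmono g hu.2 (hg u hu.1)
    rw [← natCast_zsmul, ← Int.sign_mul_self_eq_natAbs, mul_smul]
    exact Submodule.smul_mem _ _ (hle (hcb i))
  · have hspan : u ∈ saturation (heightSpan ℤ ht T (ht u)) :=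
      le_saturation _ (mem_heightSpan hu le_rfl)
    rw [h] at hspan
    refine Submodule.span_le.2 ?_ hspan
    rintro _ ⟨i, hi, rfl⟩
    exact hmono g hi (hg i)

end WeightFiltration

/-! ## Characters positive on a salient cone -/

section Cone

theorem convex_sdiff_zero_of_salient {𝕜 V : Type*} [Field 𝕜] [LinearOrder 𝕜] [IsStrictOrderedRing 𝕜]
    [AddCommGroup V] [Module 𝕜 V] {C : ConvexCone 𝕜 V} (hC : C.Salient) :
    Convex 𝕜 ((C : Set V) \ {0}) := by
  rw [convex_iff_forall_pos]
  rintro x ⟨hx, hx0⟩ y ⟨hy, -⟩ c d hc hd -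
  have hcx := C.smul_mem hc hx
  have hdy := C.smul_mem hd hy
  refine ⟨C.add_mem hcx hdy, fun hsum => hC _ hcx (smul_ne_zero hc.ne' hx0) ?_⟩
  rwa [neg_eq_of_add_eq_zero_right hsum]

theorem exists_dual_forall_pos {V : Type*} [AddCommGroup V] [Module ℝ V] [FiniteDimensional ℝ V]
    {S : Set V} (hS : S.Finite) (h0 : 0 ∉ convexHull ℝ S) :
    ∃ f : Module.Dual ℝ V, ∀ v ∈ S, 0 < f v := by
  let e := (Module.finBasis ℝ V).equivFun
  have h0' : 0 ∉ convexHull ℝ (e '' S) := by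
    rw [← LinearEquiv.coe_coe, ← LinearMap.image_convexHull]
    rintro ⟨x, hx, hex⟩
    exact h0 (e.map_eq_zero_iff.1 hex ▸ hx)
  obtain ⟨f, c, hc, hf⟩ := geometric_hahn_banach_point_closed (convex_convexHull ℝ _)
    ((hS.image e).isClosed_convexHull ℝ) h0'
  refine ⟨f.toLinearMap ∘ₗ e.toLinearMap, fun v hv => ?_⟩
  exact (map_zero f ▸ hc).trans (hf _ (subset_convexHull ℝ _ ⟨v, hv, rfl⟩))

theorem exists_pos_mul_eq_intCast {ι : Type*} [Finite ι] (q : ι → ℚ) :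
    ∃ (c : ℚ) (z : ι → ℤ), 0 < c ∧ ∀ i, (z i : ℚ) = c * q i := by
  obtain ⟨c, hc⟩ := IsLocalization.exist_integer_multiples_of_finite (nonZeroDivisors ℤ) q
  choose z hz using hc
  have hc0 : ((c : ℤ) : ℚ) ≠ 0 := Int.cast_ne_zero.2 (nonZeroDivisors.coe_ne_zero c)
  refine ⟨(c : ℤ) ^ 2, fun i => c * z i, sq_pos_of_ne_zero hc0, fun i => ?_⟩
  have hzi : (z i : ℚ) = (c : ℤ) * q i := by simpa using hz i
  rw [Int.cast_mul, hzi, sq, mul_assoc]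

theorem exists_int_dual_forall_pos_of_real {N : Type*} [AddCommGroup N] [Module.Free ℤ N]
    [Module.Finite ℤ N] {S : Set N} (hS : S.Finite) {f : Module.Dual ℝ (ℝ ⊗[ℤ] N)}
    (hf : ∀ v ∈ S, 0 < f (1 ⊗ₜ v)) : ∃ u : Module.Dual ℤ N, ∀ v ∈ S, 0 < u v := by
  let e := Module.finBasis ℤ N
  let eval (x : Fin (Module.finrank ℤ N) → ℝ) (v : N) : ℝ := ∑ i, e.repr v i * x i
  have hfeval (v : N) : f (1 ⊗ₜ v) = eval (fun i => f (1 ⊗ₜ e i)) v := by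
    conv_lhs => rw [← e.sum_repr v, TensorProduct.tmul_sum, map_sum]
    simp [eval, -Module.Basis.sum_repr]
  have hopen : IsOpen (⋂ v ∈ S, {x | 0 < eval x v}) :=
    hS.isOpen_biInter fun v _ => isOpen_lt continuous_const (by fun_prop)
  have hdense : DenseRange (Pi.map fun (_ : Fin (Module.finrank ℤ N)) (q : ℚ) => (q : ℝ)) :=
    DenseRange.piMap fun _ => Rat.denseRange_cast
  obtain ⟨q, hq⟩ := hdense.exists_mem_open hopen
    ⟨fun i => f (1 ⊗ₜ e i), Set.mem_iInter₂.2 fun v hv => (hf v hv).trans_eq (hfeval v)⟩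
  obtain ⟨c, z, hc, hz⟩ := exists_pos_mul_eq_intCast q
  refine ⟨e.constr ℤ z, fun v hv => ?_⟩
  have hzc (i) : (z i : ℝ) = c * q i := mod_cast hz i
  have heval : ((e.constr ℤ z v : ℤ) : ℝ) = c * eval (fun i => (q i : ℝ)) v := by
    simp only [Module.Basis.constr_apply_fintype, e.equivFun_apply, smul_eq_mul, Int.cast_sum,
      Int.cast_mul, hzc, eval, Finset.mul_sum, mul_left_comm]
  rw [← Int.cast_pos (R := ℝ), heval]
  exact mul_pos (Rat.cast_pos.2 hc) (Set.mem_iInter₂.1 hq v hv)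

theorem exists_int_dual_forall_pos_of_salient {N : Type*} [AddCommGroup N] [Module.Free ℤ N]
    [Module.Finite ℤ N] {σ : PointedCone ℝ (ℝ ⊗[ℤ] N)} (hsal : σ.toConvexCone.Salient)
    {S : Set N} (hS : S.Finite) (hσ : ∀ v ∈ S, (1 : ℝ) ⊗ₜ[ℤ] v ∈ σ) (h0 : 0 ∉ S) :
    ∃ u : Module.Dual ℤ N, ∀ v ∈ S, 0 < u v := by
  have hinj := Module.Flat.tensorProduct_mk_injective ℤ N ℝ
  have hsub : TensorProduct.mk ℤ ℝ N 1 '' S ⊆ (σ.toConvexCone : Set (ℝ ⊗[ℤ] N)) \ {0} := by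
    rintro _ ⟨v, hv, rfl⟩
    exact ⟨hσ v hv, fun h => h0 (hinj (h.trans (map_zero _).symm) ▸ hv)⟩
  have hnot : 0 ∉ convexHull ℝ (TensorProduct.mk ℤ ℝ N 1 '' S) := fun h =>
    (convexHull_min hsub (convex_sdiff_zero_of_salient hsal) h).2 rfl
  obtain ⟨f, hf⟩ := exists_dual_forall_pos (hS.image _) hnot
  exact exists_int_dual_forall_pos_of_real hS fun v hv => hf _ ⟨v, hv, rfl⟩

theorem mem_dualMonoid_hull {N : Type*} [AddCommGroup N] {S : Set N} {u : Module.Dual ℤ N}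
    (hu : ∀ v ∈ S, 0 ≤ u v) :
    u ∈ dualMonoid (PointedCone.hull ℝ ((fun v : N => (1 : ℝ) ⊗ₜ[ℤ] v) '' S)) := by
  intro x hx
  induction hx using Submodule.span_induction with
  | mem x hx =>
    obtain ⟨v, hv, rfl⟩ := hx
    simpa using hu v hv
  | zero => simp
  | add x y _ _ hx hy => simpa using add_nonneg hx hy
  | smul c x _ hx =>
    change 0 ≤ Module.Dual.baseChange ℝ u ((c : ℝ) • x)
    rw [map_smul]
    exact mul_nonneg c.2 hx

theorem closure_dualMonoid_eq_top {N : Type*} [AddCommGroup N] [Module.Free ℤ N]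
    [Module.Finite ℤ N] {σ : PointedCone ℝ (ℝ ⊗[ℤ] N)} (hσ : IsRationalPolyhedral σ)
    (hsal : σ.toConvexCone.Salient) :
    AddSubgroup.closure (dualMonoid σ : Set (Module.Dual ℤ N)) = ⊤ := by
  obtain ⟨S, rfl⟩ := hσ
  obtain ⟨u₀, hu₀⟩ := exists_int_dual_forall_pos_of_salient hsal (S := (S : Set N) \ {0})
    (S.finite_toSet.subset Set.sdiff_subset)
    (fun v hv => Submodule.subset_span ⟨v, hv.1, rfl⟩) (fun h => h.2 rfl)
  have hpos (v) (hv : v ∈ S) : v = 0 ∨ 0 < u₀ v := or_iff_not_imp_left.2 fun h => hu₀ v ⟨hv, h⟩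
  refine eq_top_iff.2 fun u _ => ?_
  let K : ℤ := ∑ v ∈ S, |u v|
  have hK (v) (hv : v ∈ S) : |u v| ≤ K :=
    Finset.single_le_sum (f := fun v => |u v|) (fun v _ => abs_nonneg _) hv
  rw [← add_sub_cancel_right u (K • u₀)]
  refine sub_mem (AddSubgroup.subset_closure (mem_dualMonoid_hull fun v hv => ?_))
    (AddSubgroup.subset_closure (mem_dualMonoid_hull fun v hv => ?_))
  · rcases hpos v hv with rfl | h
    · simp
    · simp only [LinearMap.add_apply, LinearMap.smul_apply, smul_eq_mul]
      nlinarith [hK v hv, neg_abs_le (u v), abs_nonneg (u v)]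
  · rcases hpos v hv with rfl | h
    · simp
    · exact mul_nonneg ((abs_nonneg _).trans (hK v hv)) h.le

theorem closure_eq_top_of_adjoin_chi {k : Type*} [CommRing k] [Nontrivial k] {S : Type*}
    [AddCommMonoid S] {G : Set S} (hG : Algebra.adjoin k (chi k '' G) = ⊤) :
    AddSubmonoid.closure G = ⊤ := by
  refine eq_top_iff.2 fun u _ => AddMonoidAlgebra.mem_closure_of_mem_span_closure (R := k) ?_
  have hu : chi k u ∈ Algebra.adjoin k (chi k '' G) := hG ▸ Algebra.mem_top
  rwa [← Subalgebra.mem_toSubmodule, Algebra.adjoin_eq_span] at hu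

end Cone

/-! ## Dimension and spanning sums -/

section Toric

variable {N : Type*} [AddCommGroup N] {σ : PointedCone ℝ (ℝ ⊗[ℤ] N)} {a : N} {k : Type*} [Field k]
  {m : ℕ} {G : Set (dualMonoid σ)}
  {b : Module.Basis (Fin (Module.finrank ℤ N)) ℤ (Module.Dual ℤ N)}
  {w : Fin (Module.finrank ℤ N) → ℕ}

theorem natCast_evalHeight (ha : (1 : ℝ) ⊗ₜ[ℤ] a ∈ σ) (u : dualMonoid σ) :
    (evalHeight a (u : Module.Dual ℤ N) : ℤ) = (u : Module.Dual ℤ N) a :=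
  Int.toNat_of_nonneg (dualMonoid_apply_nonneg ha u)

theorem heightSpan_dualMonoid (ha : (1 : ℝ) ⊗ₜ[ℤ] a ∈ σ) (hG : AddSubmonoid.closure G = ⊤) :
    heightSpan ℤ (evalHeight a) (dualMonoid σ : Set (Module.Dual ℤ N)) =
      heightSpan ℤ (evalHeight a) (Subtype.val '' G) := by
  have hclosure : AddSubmonoid.closure (Subtype.val '' G) = dualMonoid σ := by
    rw [← AddSubmonoid.coe_subtype, ← AddMonoidHom.map_mclosure, hG, ← AddMonoidHom.mrange_eq_map,
      AddSubmonoid.mrange_subtype]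
  have hadd : ∀ u ∈ AddSubmonoid.closure (Subtype.val '' G),
      ∀ v ∈ AddSubmonoid.closure (Subtype.val '' G), evalHeight a u ≤ evalHeight a (u + v) := by
    rw [hclosure]
    exact fun u _ v hv =>
      Int.toNat_le_toNat (le_add_of_nonneg_right (dualMonoid_apply_nonneg ha ⟨v, hv⟩))
  rw [← heightSpan_closure hadd, hclosure]

theorem exists_isAdapted_heightSpan [Module.Free ℤ N] [Module.Finite ℤ N]
    {T : Set (Module.Dual ℤ N)} (hT : Submodule.span ℤ T = ⊤) (ht : Module.Dual ℤ N → ℕ) :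
    ∃ (b : Module.Basis (Fin (Module.finrank ℤ N)) ℤ (Module.Dual ℤ N))
      (w : Fin (Module.finrank ℤ N) → ℕ), IsAdapted (heightSpan ℤ ht T) b w := by
  obtain ⟨J, hJ⟩ := exists_heightSpan_eq_top (ht := ht) hT
  obtain ⟨b, w, h⟩ := exists_isAdapted J heightSpan_mono
    (eq_top_iff.2 (hJ.ge.trans (le_saturation _)))
  exact ⟨_, _, h.reindex (finCongr (Module.finBasis ℤ N).toDualEquiv.finrank_eq.symm)⟩

theorem IsAdapted.exists_isSpanningTuple
    (h : IsAdapted (heightSpan ℤ (evalHeight a) (dualMonoid σ)) b w) (ha : (1 : ℝ) ⊗ₜ[ℤ] a ∈ σ)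
    (hG : AddSubmonoid.closure G = ⊤) :
    ∃ v : Fin (Module.finrank ℤ N) → dualMonoid σ, (∀ i, v i ∈ G) ∧ IsSpanningTuple v ∧
      ∀ i, (v i : Module.Dual ℤ N) a = w i := by
  obtain ⟨v, hvG, hvw, hdet⟩ := (heightSpan_dualMonoid ha hG ▸ h).exists_det_ne_zero_height_eq
  choose u huG huv using hvG
  obtain rfl : (fun i => (u i : Module.Dual ℤ N)) = v := funext huv
  exact ⟨u, huG, (span_one_tmul_eq_top_iff_det_ne_zero ℝ b _).2 hdet,
    fun i => by rw [← natCast_evalHeight ha, hvw]⟩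

theorem IsAdapted.isLeast_spanningSums
    (h : IsAdapted (heightSpan ℤ (evalHeight a) (dualMonoid σ)) b w) (ha : (1 : ℝ) ⊗ₜ[ℤ] a ∈ σ) :
    IsLeast (spanningSums σ a) (∑ i, w i : ℕ) := by
  obtain ⟨v, -, hv, hvw⟩ := h.exists_isSpanningTuple ha AddSubmonoid.closure_univ
  refine ⟨⟨v, hv, by simp [hvw]⟩, ?_⟩
  rintro _ ⟨u, hu, rfl⟩
  simp only [← natCast_evalHeight ha]
  exact_mod_cast h.sum_le_sum_of_det_ne_zero (fun i => (u i).2)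
    ((span_one_tmul_eq_top_iff_det_ne_zero ℝ b _).1 hu)

theorem IsAdapted.weight_mem_minimizingValues
    (h : IsAdapted (heightSpan ℤ (evalHeight a) (dualMonoid σ)) b w) (ha : (1 : ℝ) ⊗ₜ[ℤ] a ∈ σ)
    (hG : AddSubmonoid.closure G = ⊤) (i : Fin (Module.finrank ℤ N)) :
    (w i : ℤ) ∈ minimizingValues σ G a := by
  obtain ⟨v, hvG, hv, hvw⟩ := h.exists_isSpanningTuple ha hG
  exact ⟨v, hvG, hv, by simp [Phi, (h.isLeast_spanningSums ha).csInf_eq, hvw], i, (hvw i).symm⟩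

theorem IsAdapted.topologicalKrullDim_stabilizer [CharZero k]
    (h : IsAdapted (heightSpan ℤ (evalHeight a) (dualMonoid σ)) b w)
    {γ : JetPoint k m (AddMonoidAlgebra k (dualMonoid σ))} (hγ : γ ∈ jetOrbit k σ m a) :
    topologicalKrullDim
      (MulAction.stabilizer (JetPoint k m (AddMonoidAlgebra k (Module.Dual ℤ N))) γ) =
        (∑ i, min (w i) (m + 1) : ℕ) :=
  (congrArg (fun H : Set _ => topologicalKrullDim H) (stabilizer_eq_congruenceLocus hγ)).trans
    h.topologicalKrullDim_congruenceLocus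

theorem sum_min_eq_or_le {ι : Type*} [Fintype ι] (w : ι → ℕ) (m : ℕ) :
    ∑ i, min (w i) m = ∑ i, w i ∨ m ≤ ∑ i, min (w i) m ∧ ∑ i, min (w i) m ≤ ∑ i, w i := by
  by_cases! hw : ∀ i, w i ≤ m
  · exact Or.inl (Finset.sum_congr rfl fun i _ => min_eq_left (hw i))
  · obtain ⟨i, hi⟩ := hw
    refine Or.inr ⟨?_, Finset.sum_le_sum fun i _ => min_le_left _ _⟩
    exact (min_eq_right hi.le).ge.trans
      (Finset.single_le_sum (f := fun i => min (w i) m) (fun _ _ => Nat.zero_le _)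
        (Finset.mem_univ i))

end Toric

end

theorem mainTheorem3_general {k : Type*} [Field k] [CharZero k]
    {N : Type*} [AddCommGroup N] [Module.Free ℤ N] [Module.Finite ℤ N]
    (σ : PointedCone ℝ (ℝ ⊗[ℤ] N))
    (hσ : AddSubgroup.closure (dualMonoid σ : Set (Module.Dual ℤ N)) = ⊤)
    (a : N) (ha : (1 : ℝ) ⊗ₜ[ℤ] a ∈ σ)
    (G : Set (dualMonoid σ)) (hG : AddSubmonoid.closure G = ⊤)
    (m : ℕ) (γ : JetPoint k m (AddMonoidAlgebra k (dualMonoid σ)))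
    (hγ : γ ∈ jetOrbit k σ m a) :
    IsLeast (spanningSums σ a) (Phi σ a) ∧
    ∃ d : ℕ,
      topologicalKrullDim
        (MulAction.stabilizer (JetPoint k m (AddMonoidAlgebra k (Module.Dual ℤ N))) γ) = d ∧
      ((m : ℤ) ∈ upperBounds (minimizingValues σ G a) → (d : ℤ) = Phi σ a) ∧
      ((m : ℤ) ∉ upperBounds (minimizingValues σ G a) →
        (d : ℤ) = Phi σ a ∨ ((m : ℤ) ≤ d ∧ (d : ℤ) ≤ Phi σ a)) := by
  have hspan : Submodule.span ℤ (dualMonoid σ : Set (Module.Dual ℤ N)) = ⊤ := by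
    rw [← AddSubgroup.toIntSubmodule_closure, hσ, map_top]
  obtain ⟨b, w, hbw⟩ := exists_isAdapted_heightSpan hspan (evalHeight a)
  have hleast := hbw.isLeast_spanningSums ha
  have hPhi : Phi σ a = (∑ i, w i : ℕ) := hleast.csInf_eq
  rw [hPhi]
  refine ⟨hleast, _, hbw.topologicalKrullDim_stabilizer hγ, fun hm => ?_, fun _ => ?_⟩
  · have hw (i) : w i ≤ m + 1 := by
      have := hm (hbw.weight_mem_minimizingValues ha hG i)
      lia
    simp only [min_eq_left (hw _)]
  · norm_cast
    exact (sum_min_eq_or_le w (m + 1)).imp_right (And.imp_left (Nat.le_of_succ_le))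

theorem mainTheorem3 {k : Type*} [Field k] [IsAlgClosed k] [CharZero k]
    {N : Type*} [AddCommGroup N] [Module.Free ℤ N] [Module.Finite ℤ N]
    (σ : PointedCone ℝ (ℝ ⊗[ℤ] N)) (hσ : IsRationalPolyhedral σ)
    (hsal : σ.toConvexCone.Salient)
    (hspan : Submodule.span ℝ (σ : Set (ℝ ⊗[ℤ] N)) = ⊤)
    (a : N) (ha : (1 : ℝ) ⊗ₜ[ℤ] a ∈ coneInterior σ)
    (G : Set (dualMonoid σ)) (hG : IsMinimalMonomialGenerators k σ G)
    (m : ℕ) (γ : JetPoint k m (AddMonoidAlgebra k (dualMonoid σ)))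
    (hγ : γ ∈ jetOrbit k σ m a) :
    IsLeast (spanningSums σ a) (Phi σ a) ∧
    ∃ d : ℕ,
      topologicalKrullDim
        (MulAction.stabilizer (JetPoint k m (AddMonoidAlgebra k (Module.Dual ℤ N))) γ) = d ∧
      ((m : ℤ) ∈ upperBounds (minimizingValues σ G a) → (d : ℤ) = Phi σ a) ∧
      ((m : ℤ) ∉ upperBounds (minimizingValues σ G a) →
        (d : ℤ) = Phi σ a ∨ ((m : ℤ) ≤ d ∧ (d : ℤ) ≤ Phi σ a)) :=
  mainTheorem3_general σ (closure_dualMonoid_eq_top hσ hsal) a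
    (@interior_subset _ (moduleTopology ℝ (ℝ ⊗[ℤ] N)) (σ : Set (ℝ ⊗[ℤ] N)) _ ha) G
    (closure_eq_top_of_adjoin_chi hG.prop) m γ hγ
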